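/- Let $p$ be a prime, let $S\to R$ be a surjective homomorphism of commutative rings such that $p$ is nilpotent in $S$, and let its kernel $\mathfrak a\subset S$ be endowed with divided powers. Write $\sigma$ for the Frobenius of the ring $W(S)$ of $p$-typical Witt vectors, $V$ for the Verschiebung, $I_S=VW(S)$, and $\mathcal J=\ker(W(S)\to S\to R)=W(\mathfrak a)+I_S$. The divided powers define logarithmic coordinates $W(\mathfrak a)\cong\prod_{n\ge 0}\mathfrak a$, given by the divided Witt polynomials $\sum_{i\le n}x_i^{p^{n-i}}/p^{n-i}$, where $x^{m}/m$ means $(m-1)!\,\gamma_m(x)$. Let $\dot\sigma:\mathcal J\to W(S)$ be the extension of $V^{-1}:I_S\to W(S)$ that vanishes on the elements of $W(\mathfrak a)$ with logarithmic coordinates $[a,0,0,\ldots]$. A relative display for $S\to R$ is a quadruple $\mathcal P=(P,Q,F,\dot F)$, where $P$ is a finitely generated projective $W(S)$-module, $Q\subseteq P$ is a submodule with $\mathcal JP\subseteq Q$ such that $P/Q$ is a projective $R$-module, and $F:P\to P$ and $\dot F:Q\to P$ are $\sigma$-linear maps such that $\dot F(ax)=\dot\sigma(a)F(x)$ for $a\in\mathcal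 J$, $x\in P$, and such that $\dot F(Q)$ generates $P$. A homomorphism is a $W(S)$-linear map $P_1\to P_2$ that maps $Q_1$ into $Q_2$ and commutes with $F$ and with $\dot F$. A display over $R$ is the same with $(W(R),I_R,V^{-1})$ in place of $(W(S),\mathcal J,\dot\sigma)$. The reduction $\bar{\mathcal P}$ of $\mathcal P$ is the display over $R$ with module $\bar P=W(R)\otimes_{W(S)}P$, with $\bar Q$ the image of $Q$, and with the induced maps $\bar F(1\otimes x)=1\otimes F(x)$ and $\bar{\dot F}(1\otimes y)=1\otimes\dot F(y)$. A display $(P,Q,F,\dot F)$ over $R$ is nilpotent if, for the unique $W(R)$-linear map $V^\sharp:P\to W(R)\otimes_{F,W(R)}P$ with $V^\sharp(\dot F(y))=1\otimes y$ for $y\in Q$, some iterate $(V^N)^\sharp:P\to W(R)\otimes_{F^N,W(R)}P$ is zero modulo $I_R+pW(R)$. A relative display is nilpotent if its reduction is. Let $\mathcal P_1$ and $\mathcal P_2$ be two relative displays for $S\to R$ with reductions $\bar{\mathcal P}_1$ and $\bar{\mathcal P}_2$, and consider the reduction map $$\rho:\operatorname{Hom}(\mathcal P_1,\mathcal P_2)\to\operatorname{Hom}(\bar{\mathcal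 P}_1,\bar{\mathcal P}_2),\qquad \alpha\mapsto \mathrm{id}\otimes\alpha .$$ (a) If $\mathfrak a$ is an $S$-module of finite length, then $\rho$ is surjective. (b) If $\mathcal P_1$ and $\mathcal P_2$ are nilpotent, then $\rho$ is bijective. -/

import Mathlib

open scoped TensorProduct

universe u

/-! ## Display structures

A display over `R` and a relative display for `S → R` are both given by modules over a ring of
Witt vectors `W` together with operators that are linear over data of the following kind:
a ring homomorphism `π : W → R` with kernel `J`, the Frobenius `σ : W → W`, and a map
`σd : J → W` (the inverse of the Verschiebung, or its extension). -/

/-- Quadruples `(P, Q, F, Ḟ)` over the data `(π, σ, σd)`. -/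
structure FrameDisplay {W R : Type u} [CommRing W] [CommRing R] (π : W →+* R) (σ : W →+* W)
    (σd : RingHom.ker π → W) where
  /-- the module `P` -/
  P : Type u
  [addCommGroup : AddCommGroup P]
  [module : Module W P]
  /-- the submodule `Q ⊆ P` -/
  Q : Submodule W P
  /-- the `σ`-linear map `F : P → P` -/
  F : P →ₛₗ[σ] P
  /-- the `σ`-linear map `Ḟ : Q → P` -/
  Fdot : Q →ₛₗ[σ] P
  finite : Module.Finite W P
  projective : Module.Projective W P
  /-- `J P ⊆ Q` -/
  smul_mem : ∀ a ∈ RingHom.ker π, ∀ x : P, a • x ∈ Q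
  /-- `P / Q`, with the `R`-module structure that it has through `π`, is projective -/
  quot_projective : ∃ _ : Module R (P ⧸ Q),
    (∀ (w : W) (x : P ⧸ Q), π w • x = w • x) ∧ Module.Projective R (P ⧸ Q)
  /-- `Ḟ (a x) = σd a • F x` for `a ∈ J` and `x ∈ P` -/
  Fdot_smul : ∀ (a : RingHom.ker π) (x : P),
    Fdot ⟨(a : W) • x, smul_mem a a.2 x⟩ = σd a • F x
  /-- `Ḟ (Q)` generates `P` -/
  span_Fdot : Submodule.span W (Set.range Fdot) = ⊤

namespace FrameDisplay

attribute [instance] FrameDisplay.addCommGroup FrameDisplay.module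

section Hom

variable {W R : Type u} [CommRing W] [CommRing R] {π : W →+* R} {σ : W →+* W}
  {σd : RingHom.ker π → W}

/-- Homomorphisms: linear maps `P₁ → P₂` that map `Q₁` into `Q₂` and commute with `F` and `Ḟ`. -/
@[ext]
structure Hom (D₁ D₂ : FrameDisplay π σ σd) where
  /-- the underlying linear map -/
  toLin : D₁.P →ₗ[W] D₂.P
  map_Q : ∀ x ∈ D₁.Q, toLin x ∈ D₂.Q
  map_F : ∀ x, toLin (D₁.F x) = D₂.F (toLin x)
  map_Fdot : ∀ x : D₁.Q, toLin (D₁.Fdot x) = D₂.Fdot ⟨toLin x, map_Q x x.2⟩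

end Hom

/-! ### Base change along a surjection `A → B` over the same ring `R` -/

section BaseChange

variable {A B R : Type u} [CommRing A] [CommRing B] [CommRing R] [Algebra A B]

theorem one_tmul_surjective (hs : Function.Surjective (algebraMap A B))
    (P : Type u) [AddCommGroup P] [Module A P] :
    Function.Surjective (fun x : P => (1 : B) ⊗ₜ[A] x) := by
  intro z
  induction z using TensorProduct.induction_on with
  | zero => exact ⟨0, by simp⟩
  | tmul b x =>
    obtain ⟨a, rfl⟩ := hs b
    exact ⟨a • x, by simp [Algebra.algebraMap_eq_smul_one, TensorProduct.smul_tmul]⟩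
  | add y z hy hz =>
    obtain ⟨y, rfl⟩ := hy
    obtain ⟨z, rfl⟩ := hz
    exact ⟨y + z, by simp [TensorProduct.tmul_add]⟩

theorem one_tmul_eq_zero (hs : Function.Surjective (algebraMap A B))
    {P : Type u} [AddCommGroup P] [Module A P] {x : P} (hx : (1 : B) ⊗ₜ[A] x = 0) :
    x ∈ RingHom.ker (algebraMap A B) • (⊤ : Submodule A P) := by
  set I := RingHom.ker (algebraMap A B) with hI
  let e : B →ₐ[A] A ⧸ I :=
    (Ideal.quotientKerAlgEquivOfSurjective (f := Algebra.ofId A B) hs).symm.toAlgHom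
  have h1 := congrArg (LinearMap.rTensor P e.toLinearMap) hx
  rw [LinearMap.rTensor_tmul, map_zero] at h1
  have h2 : (1 : A ⧸ I) ⊗ₜ[A] x = 0 := by
    simpa using h1
  have h3 : x ∈ LinearMap.ker (TensorProduct.mk A (A ⧸ I) P 1) := h2
  rwa [LinearMap.ker_tensorProductMk] at h3

theorem smul_one_tmul {P : Type u} [AddCommGroup P] [Module A P] (a : A) (x : P) :
    algebraMap A B a • ((1 : B) ⊗ₜ[A] x) = (1 : B) ⊗ₜ[A] (a • x) := by
  rw [algebraMap_smul, TensorProduct.tmul_smul]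

variable {πA : A →+* R} {σA : A →+* A} {σdA : RingHom.ker πA → A}
  {πB : B →+* R} {σB : B →+* B} {σdB : RingHom.ker πB → B}

/-- The conditions under which display structures are carried along a surjection `A → B`. -/
structure BaseChangeData (σdA : RingHom.ker πA → A) (σdB : RingHom.ker πB → B)
    (σA : A →+* A) (σB : B →+* B) : Prop where
  surj : Function.Surjective (algebraMap A B)
  comm_π : ∀ a, πB (algebraMap A B a) = πA a
  comm_σ : ∀ a, σB (algebraMap A B a) = algebraMap A B (σA a)
  comm_σd : ∀ (a : RingHom.ker πA) (b : RingHom.ker πB),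
    algebraMap A B a = b → σdB b = algebraMap A B (σdA a)
  σd_zero : σdB 0 = 0

variable (D : FrameDisplay πA σA σdA) (h : BaseChangeData σdA σdB σA σB)

theorem ker_le (h : BaseChangeData σdA σdB σA σB) :
    RingHom.ker (algebraMap A B) ≤ RingHom.ker πA := by
  intro a ha
  rw [RingHom.mem_ker] at ha ⊢
  rw [← h.comm_π, ha, map_zero]

theorem one_tmul_F_eq_zero (h : BaseChangeData σdA σdB σA σB) {x : D.P}
    (hx : (1 : B) ⊗ₜ[A] x = 0) :
    (1 : B) ⊗ₜ[A] D.F x = 0 := by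
  refine Submodule.smul_induction_on (one_tmul_eq_zero h.surj hx) ?_ ?_
  · intro a ha y _
    rw [LinearMap.map_smulₛₗ, ← smul_one_tmul, ← h.comm_σ, RingHom.mem_ker.1 ha, map_zero,
      zero_smul]
  · intro y z hy hz
    rw [map_add, TensorProduct.tmul_add, hy, hz, add_zero]

theorem one_tmul_Fdot_eq_zero (h : BaseChangeData σdA σdB σA σB) {q : D.Q}
    (hx : (1 : B) ⊗ₜ[A] (q : D.P) = 0) :
    (1 : B) ⊗ₜ[A] D.Fdot q = 0 := by
  obtain ⟨x, hq⟩ := q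
  have key : ∃ hq' : x ∈ D.Q, (1 : B) ⊗ₜ[A] D.Fdot ⟨x, hq'⟩ = 0 := by
    refine Submodule.smul_induction_on
      (p := fun x => ∃ hq' : x ∈ D.Q, (1 : B) ⊗ₜ[A] D.Fdot ⟨x, hq'⟩ = 0)
      (one_tmul_eq_zero h.surj hx) ?_ ?_
    · intro a ha y _
      have ha' := ker_le h ha
      refine ⟨D.smul_mem a ha' y, ?_⟩
      rw [D.Fdot_smul ⟨a, ha'⟩ y, ← smul_one_tmul,
        ← h.comm_σd ⟨a, ha'⟩ 0 (by simpa using RingHom.mem_ker.1 ha), h.σd_zero, zero_smul]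
    · rintro y z ⟨hy, hy'⟩ ⟨hz, hz'⟩
      refine ⟨D.Q.add_mem hy hz, ?_⟩
      have : (⟨y + z, D.Q.add_mem hy hz⟩ : D.Q) = ⟨y, hy⟩ + ⟨z, hz⟩ := rfl
      rw [this, map_add, TensorProduct.tmul_add, hy', hz', add_zero]
  exact key.2

/-- The image of `Q` in `B ⊗ P`. -/
def baseChangeQ (hs : Function.Surjective (algebraMap A B)) : Submodule B (B ⊗[A] D.P) where
  carrier := {z | ∃ q ∈ D.Q, (1 : B) ⊗ₜ[A] q = z}
  zero_mem' := ⟨0, D.Q.zero_mem, by simp⟩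
  add_mem' := by
    rintro _ _ ⟨y, hy, rfl⟩ ⟨z, hz, rfl⟩
    exact ⟨y + z, D.Q.add_mem hy hz, by simp [TensorProduct.tmul_add]⟩
  smul_mem' := by
    rintro b _ ⟨y, hy, rfl⟩
    obtain ⟨a, rfl⟩ := hs b
    exact ⟨a • y, D.Q.smul_mem a hy, (smul_one_tmul a y).symm⟩

/-- The `σ`-linear map on `B ⊗ P` with `1 ⊗ x ↦ 1 ⊗ F x`. -/
noncomputable def baseChangeF : (B ⊗[A] D.P) →ₛₗ[σB] (B ⊗[A] D.P) :=
  let hex := fun z => one_tmul_surjective (B := B) h.surj D.P z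
  have spec : ∀ x : D.P,
      (1 : B) ⊗ₜ[A] D.F (hex ((1 : B) ⊗ₜ[A] x)).choose = (1 : B) ⊗ₜ[A] D.F x := by
    intro x
    have h0 := (hex ((1 : B) ⊗ₜ[A] x)).choose_spec
    have h1 := one_tmul_F_eq_zero D h
      (x := (hex ((1 : B) ⊗ₜ[A] x)).choose - x)
      (by rw [TensorProduct.tmul_sub]; exact sub_eq_zero.2 h0)
    rw [map_sub, TensorProduct.tmul_sub] at h1
    exact sub_eq_zero.1 h1
  { toFun := fun z => (1 : B) ⊗ₜ[A] D.F (hex z).choose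
    map_add' := by
      intro y z
      obtain ⟨y, rfl⟩ := hex y
      obtain ⟨z, rfl⟩ := hex z
      change (1 : B) ⊗ₜ[A] D.F (hex ((1 : B) ⊗ₜ[A] y + (1 : B) ⊗ₜ[A] z)).choose = _
      rw [← TensorProduct.tmul_add, spec, spec, spec, map_add, TensorProduct.tmul_add]
    map_smul' := by
      intro b z
      obtain ⟨a, rfl⟩ := h.surj b
      obtain ⟨z, rfl⟩ := hex z
      change (1 : B) ⊗ₜ[A] D.F (hex (algebraMap A B a • ((1 : B) ⊗ₜ[A] z))).choose = _
      rw [smul_one_tmul, spec, spec, LinearMap.map_smulₛₗ, ← smul_one_tmul, h.comm_σ] }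

theorem baseChangeF_one_tmul (x : D.P) :
    baseChangeF D h ((1 : B) ⊗ₜ[A] x) = (1 : B) ⊗ₜ[A] D.F x := by
  have h0 := (one_tmul_surjective (B := B) h.surj D.P ((1 : B) ⊗ₜ[A] x)).choose_spec
  have h1 := one_tmul_F_eq_zero D h
    (x := (one_tmul_surjective (B := B) h.surj D.P ((1 : B) ⊗ₜ[A] x)).choose - x)
    (by rw [TensorProduct.tmul_sub]; exact sub_eq_zero.2 h0)
  rw [map_sub, TensorProduct.tmul_sub] at h1
  exact sub_eq_zero.1 h1

theorem one_tmul_mem_baseChangeQ (q : D.Q) :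
    (1 : B) ⊗ₜ[A] (q : D.P) ∈ baseChangeQ D h.surj := ⟨q, q.2, rfl⟩

theorem exists_baseChangeQ (z : baseChangeQ D h.surj) :
    ∃ q : D.Q, (⟨(1 : B) ⊗ₜ[A] (q : D.P), one_tmul_mem_baseChangeQ D h q⟩ :
      baseChangeQ D h.surj) = z := by
  obtain ⟨_, q, hq, rfl⟩ := z
  exact ⟨⟨q, hq⟩, rfl⟩

theorem one_tmul_Fdot_choose (q : D.Q) :
    (1 : B) ⊗ₜ[A] D.Fdot (exists_baseChangeQ D h
      ⟨(1 : B) ⊗ₜ[A] (q : D.P), one_tmul_mem_baseChangeQ D h q⟩).choose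
      = (1 : B) ⊗ₜ[A] D.Fdot q := by
  have h0 := congrArg Subtype.val (exists_baseChangeQ D h
      ⟨(1 : B) ⊗ₜ[A] (q : D.P), one_tmul_mem_baseChangeQ D h q⟩).choose_spec
  have h1 := one_tmul_Fdot_eq_zero D h
    (q := (exists_baseChangeQ D h
      ⟨(1 : B) ⊗ₜ[A] (q : D.P), one_tmul_mem_baseChangeQ D h q⟩).choose - q)
    (by rw [Submodule.coe_sub, TensorProduct.tmul_sub]; exact sub_eq_zero.2 h0)
  rw [map_sub, TensorProduct.tmul_sub] at h1
  exact sub_eq_zero.1 h1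

/-- The `σ`-linear map on the image of `Q` in `B ⊗ P` with `1 ⊗ q ↦ 1 ⊗ Ḟ q`. -/
noncomputable def baseChangeFdot : baseChangeQ D h.surj →ₛₗ[σB] (B ⊗[A] D.P) where
  toFun z := (1 : B) ⊗ₜ[A] D.Fdot (exists_baseChangeQ D h z).choose
  map_add' := by
    intro y z
    obtain ⟨y, rfl⟩ := exists_baseChangeQ D h y
    obtain ⟨z, rfl⟩ := exists_baseChangeQ D h z
    have e : (⟨(1 : B) ⊗ₜ[A] (y : D.P), one_tmul_mem_baseChangeQ D h y⟩ : baseChangeQ D h.surj)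
        + ⟨(1 : B) ⊗ₜ[A] (z : D.P), one_tmul_mem_baseChangeQ D h z⟩
        = ⟨(1 : B) ⊗ₜ[A] ((y + z : D.Q) : D.P), one_tmul_mem_baseChangeQ D h (y + z)⟩ :=
      Subtype.ext (TensorProduct.tmul_add _ _ _).symm
    rw [e, one_tmul_Fdot_choose D h, one_tmul_Fdot_choose D h, one_tmul_Fdot_choose D h, map_add,
      TensorProduct.tmul_add]
  map_smul' := by
    intro b z
    obtain ⟨a, rfl⟩ := h.surj b
    obtain ⟨z, rfl⟩ := exists_baseChangeQ D h z
    have e : algebraMap A B a • (⟨(1 : B) ⊗ₜ[A] (z : D.P), one_tmul_mem_baseChangeQ D h z⟩ :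
        baseChangeQ D h.surj)
        = ⟨(1 : B) ⊗ₜ[A] ((a • z : D.Q) : D.P), one_tmul_mem_baseChangeQ D h (a • z)⟩ :=
      Subtype.ext (smul_one_tmul _ _)
    rw [e, one_tmul_Fdot_choose D h, one_tmul_Fdot_choose D h, LinearMap.map_smulₛₗ, ← smul_one_tmul,
      h.comm_σ]

theorem baseChangeFdot_one_tmul (q : D.Q) (hq : (1 : B) ⊗ₜ[A] (q : D.P) ∈ baseChangeQ D h.surj) :
    baseChangeFdot D h ⟨(1 : B) ⊗ₜ[A] (q : D.P), hq⟩ = (1 : B) ⊗ₜ[A] D.Fdot q :=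
  one_tmul_Fdot_choose D h q

theorem baseChangeFdot_congr {y z : B ⊗[A] D.P} (e : y = z) (hy : y ∈ baseChangeQ D h.surj)
    (hz : z ∈ baseChangeQ D h.surj) :
    baseChangeFdot D h ⟨y, hy⟩ = baseChangeFdot D h ⟨z, hz⟩ := by
  subst e
  rfl

/-- `P / Q` does not change under base change. -/
theorem bijective_quot :
    ∃ e : (D.P ⧸ D.Q) ≃+ ((B ⊗[A] D.P) ⧸ baseChangeQ D h.surj), ∀ x : D.P,
      e (Submodule.Quotient.mk x) = Submodule.Quotient.mk ((1 : B) ⊗ₜ[A] x) := by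
  let f : D.P →+ ((B ⊗[A] D.P) ⧸ baseChangeQ D h.surj) :=
    ((baseChangeQ D h.surj).mkQ.toAddMonoidHom).comp
      (TensorProduct.mk A B D.P 1).toAddMonoidHom
  have hf : ∀ x, f x = Submodule.Quotient.mk ((1 : B) ⊗ₜ[A] x) := fun _ => rfl
  have hker : ∀ x, f x = 0 ↔ x ∈ D.Q := by
    intro x
    rw [hf, Submodule.Quotient.mk_eq_zero]
    constructor
    · rintro ⟨q, hq, e⟩
      have h1 := one_tmul_eq_zero (B := B) h.surj (x := x - q)
        (by rw [TensorProduct.tmul_sub, e, sub_self])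
      have h2 : x - q ∈ D.Q := by
        refine Submodule.smul_le.2 (fun a ha y _ => D.smul_mem a (ker_le h ha) y) h1
      simpa using D.Q.add_mem h2 hq
    · intro hx
      exact ⟨x, hx, rfl⟩
  let g : (D.P ⧸ D.Q) →+ ((B ⊗[A] D.P) ⧸ baseChangeQ D h.surj) :=
    QuotientAddGroup.lift D.Q.toAddSubgroup f (fun x hx => (hker x).2 hx)
  have hg : ∀ x, g (Submodule.Quotient.mk x) = Submodule.Quotient.mk ((1 : B) ⊗ₜ[A] x) :=
    fun _ => rfl
  refine ⟨AddEquiv.ofBijective g ⟨?_, ?_⟩, hg⟩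
  · rw [injective_iff_map_eq_zero]
    intro z hz
    obtain ⟨x, rfl⟩ := Submodule.Quotient.mk_surjective _ z
    exact (Submodule.Quotient.mk_eq_zero _).2 ((hker x).1 hz)
  · intro z
    obtain ⟨z, rfl⟩ := Submodule.Quotient.mk_surjective _ z
    obtain ⟨x, rfl⟩ := one_tmul_surjective (B := B) h.surj D.P z
    exact ⟨Submodule.Quotient.mk x, rfl⟩

/-- The base change `(B ⊗ P, image of Q, F, Ḟ)` with `F (1 ⊗ x) = 1 ⊗ F x` and
`Ḟ (1 ⊗ q) = 1 ⊗ Ḟ q`. -/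
noncomputable def baseChange : FrameDisplay πB σB σdB where
  P := B ⊗[A] D.P
  Q := baseChangeQ D h.surj
  F := baseChangeF D h
  Fdot := baseChangeFdot D h
  finite := by
    have := D.finite
    infer_instance
  projective := by
    have := D.projective
    infer_instance
  smul_mem := by
    intro b hb z
    obtain ⟨a, rfl⟩ := h.surj b
    obtain ⟨x, rfl⟩ := one_tmul_surjective (B := B) h.surj D.P z
    refine ⟨a • x, D.smul_mem a ?_ x, (smul_one_tmul a x).symm⟩
    rwa [RingHom.mem_ker, h.comm_π] at hb
  quot_projective := by
    obtain ⟨m, hm, hproj⟩ := D.quot_projective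
    obtain ⟨e, he⟩ := bijective_quot D h
    let m' : Module R ((B ⊗[A] D.P) ⧸ baseChangeQ D h.surj) := e.symm.module R
    have hsm : ∀ (r : R) (x), r • x = e (r • e.symm x) := fun _ _ => rfl
    refine ⟨m', ?_, ?_⟩
    · intro b x
      obtain ⟨a, rfl⟩ := h.surj b
      obtain ⟨x, rfl⟩ := e.surjective x
      obtain ⟨x, rfl⟩ := Submodule.Quotient.mk_surjective _ x
      rw [hsm, e.symm_apply_apply, h.comm_π, hm, ← Submodule.Quotient.mk_smul, he, he,
        ← Submodule.Quotient.mk_smul, smul_one_tmul]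
    · let l : (D.P ⧸ D.Q) ≃ₗ[R] ((B ⊗[A] D.P) ⧸ baseChangeQ D h.surj) :=
        { e with
          map_smul' := by
            intro r x
            change e (r • x) = r • e x
            rw [hsm, e.symm_apply_apply] }
      exact Module.Projective.of_equiv l
  Fdot_smul := by
    intro b z
    obtain ⟨b, hb⟩ := b
    obtain ⟨a, rfl⟩ := h.surj b
    obtain ⟨x, rfl⟩ := one_tmul_surjective (B := B) h.surj D.P z
    have ha : a ∈ RingHom.ker πA := by
      rwa [RingHom.mem_ker, h.comm_π] at hb
    rw [h.comm_σd ⟨a, ha⟩ ⟨_, hb⟩ rfl]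
    have e := baseChangeFdot_one_tmul D h ⟨a • x, D.smul_mem a ha x⟩
      ⟨a • x, D.smul_mem a ha x, rfl⟩
    rw [D.Fdot_smul ⟨a, ha⟩ x] at e
    refine Eq.trans ?_ (congrArg _ (baseChangeF_one_tmul D h x)).symm
    exact (baseChangeFdot_congr D h (smul_one_tmul a x) _ _).trans
      (e.trans (smul_one_tmul _ _).symm)
  span_Fdot := by
    rw [eq_top_iff]
    rintro z -
    obtain ⟨x, rfl⟩ := one_tmul_surjective (B := B) h.surj D.P z
    have hx : x ∈ Submodule.span A (Set.range D.Fdot) := by rw [D.span_Fdot]; trivial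
    induction hx using Submodule.span_induction with
    | mem y hy =>
      obtain ⟨q, rfl⟩ := hy
      exact Submodule.subset_span ⟨⟨_, q, q.2, rfl⟩, baseChangeFdot_one_tmul D h q _⟩
    | zero => simp
    | add y z _ _ hy hz =>
      simp only [TensorProduct.tmul_add]
      exact Submodule.add_mem _ hy hz
    | smul a y _ hy =>
      simp only [← smul_one_tmul]
      exact Submodule.smul_mem _ _ hy

/-- The base change `id ⊗ α` of a homomorphism `α`. -/
noncomputable def Hom.baseChange {D₁ D₂ : FrameDisplay πA σA σdA}
    (h : BaseChangeData σdA σdB σA σB) (α : Hom D₁ D₂) :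
    Hom (D₁.baseChange h) (D₂.baseChange h) where
  toLin := α.toLin.baseChange B
  map_Q := by
    rintro _ ⟨q, hq, rfl⟩
    exact ⟨α.toLin q, α.map_Q q hq, (LinearMap.baseChange_tmul _ _ _).symm⟩
  map_F := by
    intro z
    obtain ⟨x, rfl⟩ := one_tmul_surjective (B := B) h.surj D₁.P z
    change α.toLin.baseChange B (baseChangeF D₁ h ((1 : B) ⊗ₜ[A] x)) =
      baseChangeF D₂ h (α.toLin.baseChange B ((1 : B) ⊗ₜ[A] x))
    rw [baseChangeF_one_tmul, LinearMap.baseChange_tmul, LinearMap.baseChange_tmul,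
      baseChangeF_one_tmul, α.map_F]
  map_Fdot := by
    rintro ⟨_, q, hq, rfl⟩
    have e1 := baseChangeFdot_one_tmul D₁ h ⟨q, hq⟩ ⟨q, hq, rfl⟩
    have e2 := baseChangeFdot_one_tmul D₂ h ⟨α.toLin q, α.map_Q q hq⟩
      ⟨α.toLin q, α.map_Q q hq, rfl⟩
    rw [← α.map_Fdot ⟨q, hq⟩] at e2
    change α.toLin.baseChange B (baseChangeFdot D₁ h ⟨(1 : B) ⊗ₜ[A] q, _⟩) = _
    rw [e1, LinearMap.baseChange_tmul, ← e2]
    rfl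

end BaseChange

end FrameDisplay

/-! ## The twist of a module by a ring endomorphism -/

section Twist

/-- The ring `W`, regarded as an algebra over `W` through `f : W → W`. -/
def TwistRing {W : Type u} [CommRing W] (_f : W →+* W) : Type u := W

instance {W : Type u} [CommRing W] (f : W →+* W) : CommRing (TwistRing f) :=
  inferInstanceAs (CommRing W)

instance {W : Type u} [CommRing W] (f : W →+* W) : Algebra W (TwistRing f) :=
  RingHom.toAlgebra (S := TwistRing f) f

/-- The module `W ⊗_{f, W} M`, in which `a ⊗ c • x = a * f c ⊗ x`. -/
def Twist {W : Type u} [CommRing W] (f : W →+* W) (M : Type u) [AddCommGroup M] [Module W M] :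
    Type u := TwistRing f ⊗[W] M

variable {W : Type u} [CommRing W] (f : W →+* W) {M N : Type u} [AddCommGroup M] [Module W M]
  [AddCommGroup N] [Module W N]

noncomputable instance : AddCommGroup (Twist f M) :=
  inferInstanceAs (AddCommGroup (TwistRing f ⊗[W] M))

/-- `W` acts on `W ⊗_{f, W} M` through the left factor: `b • (a ⊗ x) = b * a ⊗ x`. -/
noncomputable instance : Module W (Twist f M) :=
  inferInstanceAs (Module (TwistRing f) (TwistRing f ⊗[W] M))

/-- The element `a ⊗ x` of `W ⊗_{f, W} M`. -/
def Twist.tmul (a : W) (x : M) : Twist f M := TensorProduct.tmul W (show TwistRing f from a) x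

theorem Twist.smul_tmul (a b : W) (x : M) : b • Twist.tmul f a x = Twist.tmul f (b * a) x := rfl

theorem Twist.tmul_smul (a c : W) (x : M) :
    Twist.tmul f a (c • x) = Twist.tmul f (a * f c) x := by
  change (show TwistRing f from a) ⊗ₜ[W] (c • x) = (show TwistRing f from a * f c) ⊗ₜ[W] x
  rw [← TensorProduct.smul_tmul, Algebra.smul_def, mul_comm]
  rfl

/-- The linear map `W ⊗_{f, W} M → W ⊗_{f, W} N` with `a ⊗ x ↦ a ⊗ g x`. -/
noncomputable def Twist.map (g : M →ₗ[W] N) : Twist f M →ₗ[W] Twist f N :=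
  (show TwistRing f ⊗[W] M →ₗ[TwistRing f] TwistRing f ⊗[W] N from g.baseChange (TwistRing f))

theorem Twist.map_tmul (g : M →ₗ[W] N) (a : W) (x : M) :
    Twist.map f g (Twist.tmul f a x) = Twist.tmul f a (g x) := rfl

end Twist

/-! ## Displays over a ring -/

section Displays

variable (p : ℕ) [Fact p.Prime]

/-- The inverse of the Verschiebung, on the ideal `I_R = V W(R)`, which is the kernel of
`W(R) → R`. -/
def verschiebungInv (R : Type u) [CommRing R]
    (x : RingHom.ker (WittVector.constantCoeff : WittVector p R →+* R)) : WittVector p R :=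
  (x : WittVector p R).shift 1

theorem verschiebung_verschiebungInv (R : Type u) [CommRing R]
    (x : RingHom.ker (WittVector.constantCoeff : WittVector p R →+* R)) :
    WittVector.verschiebung (verschiebungInv p R x) = (x : WittVector p R) := by
  have h0 : (x : WittVector p R).coeff 0 = 0 := x.2
  rw [verschiebungInv, WittVector.verschiebung_shift (x : WittVector p R) 0 (by simpa using h0)]
  ext n
  simp [WittVector.shift_coeff]

/-- Displays over `R`. -/
abbrev Display (R : Type u) [CommRing R] : Type (u + 1) :=
  FrameDisplay (WittVector.constantCoeff : WittVector p R →+* R) WittVector.frobenius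
    (verschiebungInv p R)

variable {p}

/-- The `N`-th iterate `W ⊗_{f^N, W} M = W ⊗_{f, W} (W ⊗_{f, W} (⋯ (W ⊗_{f, W} M)))`. -/
noncomputable def iterTwist {W : Type u} [CommRing W] (f : W →+* W) (M : Type u)
    [AddCommGroup M] [Module W M] : ℕ → ModuleCat.{u} W
  | 0 => ModuleCat.of W M
  | N + 1 => ModuleCat.of W (Twist f (iterTwist f M N))

/-- The iterates `V^N : M → W ⊗_{f^N, W} M` of a linear map `V : M → W ⊗_{f, W} M`. -/
noncomputable def iterSharp {W : Type u} [CommRing W] (f : W →+* W) {M : Type u}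
    [AddCommGroup M] [Module W M] (V : M →ₗ[W] Twist f M) : (N : ℕ) → (M →ₗ[W] iterTwist f M N)
  | 0 => LinearMap.id
  | N + 1 => (Twist.map f (iterSharp f V N)).comp V

/-- A display over `R` is nilpotent if, for the unique `W(R)`-linear map
`V♯ : P → W(R) ⊗_{F, W(R)} P` with `V♯ (Ḟ y) = 1 ⊗ y` for `y ∈ Q`, some iterate
`P → W(R) ⊗_{F^N, W(R)} P` is zero modulo the ideal `I_R + p W(R)`. -/
def Display.IsNilpotent {R : Type u} [CommRing R] (D : Display p R) : Prop :=
  ∃ V : D.P →ₗ[WittVector p R] Twist (WittVector.frobenius : WittVector p R →+* _) D.P,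
    (∀ y : D.Q, V (D.Fdot y) = Twist.tmul _ 1 (y : D.P)) ∧
    ∃ N : ℕ, ∀ x : D.P, iterSharp WittVector.frobenius V N x ∈
      ((RingHom.ker (WittVector.constantCoeff : WittVector p R →+* R) ⊔
        Ideal.span {(p : WittVector p R)}) •
        (⊤ : Submodule (WittVector p R) (iterTwist WittVector.frobenius D.P N)))

end Displays

/-! ## Relative displays for a divided power extension -/

section Relative

variable (p : ℕ) [Fact p.Prime]

/-- The `n`-th divided Witt polynomial `∑ x_i ^ (p ^ (n - i)) / p ^ (n - i)`, where
`x ^ m / m` stands for `(m - 1)! • γ_m (x)`: the `n`-th logarithmic coordinate of a Witt vector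
with components in an ideal with divided powers `γ`. -/
noncomputable def logCoord {S : Type u} [CommRing S] {I : Ideal S} (γ : DividedPowers I)
    (x : WittVector p S) (n : ℕ) : S :=
  ∑ i ∈ Finset.range (n + 1),
    ((p ^ (n - i) - 1).factorial : S) * γ.dpow (p ^ (n - i)) (x.coeff i)

/-- The components of the Witt vector with logarithmic coordinates `[a, 0, 0, …]`. -/
noncomputable def logTeichCoeff {S : Type u} [CommRing S] {I : Ideal S} (γ : DividedPowers I)
    (a : S) : ℕ → S
  | 0 => a
  | n + 1 => - ∑ i : Fin (n + 1), ((p ^ (n + 1 - (i : ℕ)) - 1).factorial : S) *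
      γ.dpow (p ^ (n + 1 - (i : ℕ))) (logTeichCoeff γ a i)

/-- The Witt vector with logarithmic coordinates `[a, 0, 0, …]`. -/
noncomputable def logTeich {S : Type u} [CommRing S] {I : Ideal S} (γ : DividedPowers I)
    (a : S) : WittVector p S :=
  WittVector.mk p (logTeichCoeff p γ a)

variable {S : Type u} [CommRing S] {I : Ideal S} (γ : DividedPowers I)

set_option linter.unusedSectionVars false

theorem logTeich_coeff_zero (a : S) : (logTeich p γ a).coeff 0 = a := by
  simp [logTeich, logTeichCoeff]

theorem logTeich_coeff_mem {a : S} (ha : a ∈ I) (n : ℕ) : (logTeich p γ a).coeff n ∈ I := by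
  change logTeichCoeff p γ a n ∈ I
  induction n using Nat.strong_induction_on with
  | _ n ih =>
    cases n with
    | zero => simpa [logTeichCoeff] using ha
    | succ n =>
      rw [logTeichCoeff]
      refine I.neg_mem (I.sum_mem fun i _ => I.mul_mem_left _ (γ.dpow_mem ?_ (ih i i.2)))
      exact pow_ne_zero _ (Fact.out : p.Prime).ne_zero

theorem logCoord_logTeich {a : S} (ha : a ∈ I) (n : ℕ) :
    logCoord p γ (logTeich p γ a) n = if n = 0 then a else 0 := by
  have hlast := γ.dpow_one (logTeich_coeff_mem p γ ha n)
  rw [logCoord, Finset.sum_range_succ]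
  simp only [Nat.sub_self, pow_zero, Nat.factorial_zero, Nat.cast_one, one_mul]
  rw [hlast]
  cases n with
  | zero => simp [logTeich_coeff_zero]
  | succ n =>
    have : (logTeich p γ a).coeff (n + 1) = logTeichCoeff p γ a (n + 1) := rfl
    rw [this, logTeichCoeff, Finset.sum_range, if_neg (Nat.succ_ne_zero n)]
    exact add_neg_cancel _

/-- An element of `W(I)` is determined by its logarithmic coordinates. -/
theorem eq_of_logCoord_eq {x y : WittVector p S} (hx : ∀ n, x.coeff n ∈ I)
    (hy : ∀ n, y.coeff n ∈ I) (h : ∀ n, logCoord p γ x n = logCoord p γ y n) : x = y := by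
  ext n
  induction n using Nat.strong_induction_on with
  | _ n ih =>
    have h1 := h n
    rw [logCoord, logCoord, Finset.sum_range_succ, Finset.sum_range_succ] at h1
    simp only [Nat.sub_self, pow_zero, Nat.factorial_zero, Nat.cast_one, one_mul] at h1
    rw [γ.dpow_one (hx n), γ.dpow_one (hy n),
      Finset.sum_congr rfl (fun i hi => by rw [ih i (Finset.mem_range.1 hi)])] at h1
    exact add_left_cancel h1

theorem logTeich_zero : logTeich p γ 0 = 0 := by
  ext n
  change logTeichCoeff p γ 0 n = (0 : WittVector p S).coeff n
  rw [WittVector.zero_coeff]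
  induction n using Nat.strong_induction_on with
  | _ n ih =>
    cases n with
    | zero => simp [logTeichCoeff]
    | succ n =>
      rw [logTeichCoeff, neg_eq_zero]
      refine Finset.sum_eq_zero fun i _ => ?_
      rw [ih i i.2, γ.dpow_eval_zero (pow_ne_zero _ (Fact.out : p.Prime).ne_zero), mul_zero]

variable {R : Type u} [CommRing R] [Algebra S R]

variable (S R) in
/-- The homomorphism `W(S) → S → R`, whose kernel is the ideal `J` of `W(S)`. -/
noncomputable def wittToResidue : WittVector p S →+* R :=
  (algebraMap S R).comp WittVector.constantCoeff

variable (γR : DividedPowers (RingHom.ker (algebraMap S R)))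

/-- The map `J → W(S)` that extends the inverse of the Verschiebung and that vanishes on the
elements of `W(𝔞)` with logarithmic coordinates `[a, 0, 0, …]`, where `𝔞` is the kernel of
`S → R`. An element of `J` with first component `a` is the sum of such an element and an element
of `V W(S)`. -/
noncomputable def relSigmaDot (x : RingHom.ker (wittToResidue p S R)) : WittVector p S :=
  ((x : WittVector p S) - logTeich p γR ((x : WittVector p S).coeff 0)).shift 1

theorem relSigmaDot_spec (x : RingHom.ker (wittToResidue p S R)) :
    (x : WittVector p S) = logTeich p γR ((x : WittVector p S).coeff 0) +
      WittVector.verschiebung (relSigmaDot p γR x) := by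
  set z := (x : WittVector p S) - logTeich p γR ((x : WittVector p S).coeff 0) with hz
  have h0 : z.coeff 0 = 0 := by
    change WittVector.constantCoeff z = 0
    rw [hz, map_sub]
    change (x : WittVector p S).coeff 0 - (logTeich p γR _).coeff 0 = 0
    rw [logTeich_coeff_zero, sub_self]
  have h1 := verschiebung_verschiebungInv p S ⟨z, h0⟩
  change WittVector.verschiebung (relSigmaDot p γR x) = z at h1
  rw [h1, hz]
  ring

theorem relSigmaDot_eq (x : RingHom.ker (wittToResidue p S R)) (a : S) (y : WittVector p S)
    (h : (x : WittVector p S) = logTeich p γR a + WittVector.verschiebung y) :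
    relSigmaDot p γR x = y := by
  have h0 : (x : WittVector p S).coeff 0 = a := by
    change WittVector.constantCoeff (x : WittVector p S) = a
    rw [h, map_add]
    change (logTeich p γR a).coeff 0 + (WittVector.verschiebung y).coeff 0 = a
    rw [logTeich_coeff_zero, WittVector.verschiebung_coeff_zero, add_zero]
  ext n
  rw [relSigmaDot, h0, h, add_sub_cancel_left, WittVector.shift_coeff, add_comm,
    WittVector.verschiebung_coeff_succ]

/-- Relative displays for `S → R`. -/
abbrev RelDisplay : Type (u + 1) :=
  FrameDisplay (wittToResidue p S R) WittVector.frobenius (relSigmaDot p γR)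

theorem reduction_baseChangeData (hs : Function.Surjective (algebraMap S R)) :
    letI : Algebra (WittVector p S) (WittVector p R) :=
      (WittVector.map (algebraMap S R)).toAlgebra
    FrameDisplay.BaseChangeData (relSigmaDot p γR) (verschiebungInv p R)
      WittVector.frobenius WittVector.frobenius := by
  let _ : Algebra (WittVector p S) (WittVector p R) :=
    (WittVector.map (algebraMap S R)).toAlgebra
  have hmap : ∀ x : WittVector p S, algebraMap (WittVector p S) (WittVector p R) x =
      WittVector.map (algebraMap S R) x := fun _ => rfl
  refine ⟨WittVector.map_surjective _ hs, fun a => ?_, fun a => ?_, fun a b hab => ?_, ?_⟩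
  · rw [hmap]
    change (WittVector.map (algebraMap S R) a).coeff 0 = algebraMap S R (a.coeff 0)
    rw [WittVector.map_coeff]
  · rw [hmap, hmap]
    exact (WittVector.IsPoly.map (WittVector.frobenius_isPoly p) (algebraMap S R) a).symm
  · have ha : (a : WittVector p S).coeff 0 ∈ RingHom.ker (algebraMap S R) := a.2
    have hl : WittVector.map (algebraMap S R)
        (logTeich p γR ((a : WittVector p S).coeff 0)) = 0 := by
      ext n
      rw [WittVector.map_coeff, WittVector.zero_coeff]
      exact logTeich_coeff_mem p γR ha n
    rw [hmap] at hab ⊢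
    ext n
    rw [verschiebungInv, WittVector.shift_coeff, ← hab, WittVector.map_coeff (algebraMap S R),
      WittVector.map_coeff, relSigmaDot, WittVector.shift_coeff, ← WittVector.map_coeff,
      ← WittVector.map_coeff, map_sub, hl, sub_zero]
  · ext n
    simp [verschiebungInv, WittVector.shift_coeff]

variable {p} {γR}

/-- The reduction of a relative display for `S → R` to a display over `R`: its module is
`W(R) ⊗_{W(S)} P`, with the image of `Q` and the induced operators. -/
noncomputable def RelDisplay.reduction (D : RelDisplay p γR)
    (hs : Function.Surjective (algebraMap S R)) : Display p R :=
  letI : Algebra (WittVector p S) (WittVector p R) :=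
    (WittVector.map (algebraMap S R)).toAlgebra
  FrameDisplay.baseChange D (reduction_baseChangeData p γR hs)

/-- The reduction map on homomorphisms, `α ↦ id ⊗ α`. -/
noncomputable def RelDisplay.reductionHom (D₁ D₂ : RelDisplay p γR)
    (hs : Function.Surjective (algebraMap S R)) (α : FrameDisplay.Hom D₁ D₂) :
    FrameDisplay.Hom (RelDisplay.reduction D₁ hs) (RelDisplay.reduction D₂ hs) :=
  letI : Algebra (WittVector p S) (WittVector p R) :=
    (WittVector.map (algebraMap S R)).toAlgebra
  FrameDisplay.Hom.baseChange (reduction_baseChangeData p γR hs) α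

end Relative

/-! ## A torsion-free cover of a ring with divided powers -/

/-! Let K be the kernel of P₂ → W(R) ⊗ P₂. It equals W(𝔞)P₂, lies in Q₂ and is stable under Ḟ. The
engine is a universal property of displays (`exists_lift`): if σ-linear maps F' on P and Ḟ' on Q
with values in a module N satisfy Ḟ'(ax) = σ̇(a)F'(x), then Ḟ' = u ∘ Ḟ for a linear map u : P → N.
In particular every linear β : P₁ → K has a transform Uβ : P₁ → K with Uβ ∘ Ḟ = Ḟ ∘ β.

A homomorphism of reductions lifts to a linear map α₀. If u ∘ Ḟ = Ḟ ∘ α₀, then ε = α₀ - u has values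
in K, and α₀ - β is a homomorphism as soon as β = ε + Uβ. Two lifts of the same homomorphism differ
by a solution of β = Uβ. So the theorem is about 1 - U on Hom(P₁, K).

For (b), U^N factors through (V^N)♯, which vanishes modulo I_R + pW(R). One further step applies σ
to coefficients over that ideal and produces a factor p. Iteration produces p^j, which kills W(𝔞)
when p^j = 0 in S. So U is nilpotent and a geometric series inverts 1 - U.

For (a), generators of Hom(P₁, P₂) turn the equation into a finite system for elements of W(𝔞). In
logarithmic coordinates σ̇ is the shift, and multiplication by w is multiplication by the ghost
components of w. The system becomes b_k = ε_k + u_k(b_{k+1}) in a power of 𝔞, which a Mittag-Leffler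
argument solves because 𝔞 is artinian (`exists_forall_eq_add_of_isArtinian`).

Both parts use that logarithmic coordinates are additive and linear over ghost components
(`logCoord_add`, `logCoord_mul`). This is checked in a torsion-free cover, where the n-th coordinate
is the n-th ghost component divided by p^n. -/

section Cover

open MvPolynomial

variable {S : Type u} [CommRing S] {I : Ideal S} (γ : DividedPowers I)

/-- The denominators of the monomials of the cover: divided powers for the variables indexed by `I`,
ordinary powers for the variables indexed by `S`. -/
noncomputable def coverCoeff (i : I ⊕ S) (n : ℕ) : ℚ :=
  Sum.elim (fun _ => ((n.factorial : ℚ))⁻¹) (fun _ => 1) i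

/-- The values of the monomials of the cover. -/
noncomputable def coverValue (i : I ⊕ S) (n : ℕ) : S :=
  Sum.elim (fun a : I => γ.dpow n (a : S)) (fun s => s ^ n) i

theorem coverCoeff_ne_zero (i : I ⊕ S) (n : ℕ) : coverCoeff i n ≠ 0 := by
  rcases i with a | s
  · simp [coverCoeff, Nat.factorial_ne_zero]
  · simp [coverCoeff]

/-- The same binomial coefficient governs X^m/m! · X^n/n! and γ_m(a) · γ_n(a). Hence the integral
span of the pairs is closed under multiplication. -/
theorem cover_mul (i : I ⊕ S) (m n : ℕ) : ∃ b : ℕ,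
    coverCoeff i m * coverCoeff i n = b * coverCoeff i (m + n) ∧
    coverValue γ i m * coverValue γ i n = b * coverValue γ i (m + n) := by
  rcases i with a | s
  · refine ⟨(m + n).choose m, ?_, γ.mul_dpow a.2⟩
    simp only [coverCoeff, Sum.elim_inl]
    rw [Nat.cast_add_choose]
    have := Nat.cast_ne_zero (R := ℚ).2 (Nat.factorial_ne_zero (m + n))
    field_simp
  · exact ⟨1, by simp [coverCoeff], by simp [coverValue, pow_add]⟩

/-- The pairs of a monomial with denominators and its value. -/
noncomputable def coverMonomial (m : (I ⊕ S) →₀ ℕ) : MvPolynomial (I ⊕ S) ℚ × S :=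
  (monomial m (m.prod coverCoeff), m.prod (coverValue γ))

theorem coverCoeff_zero (i : I ⊕ S) : coverCoeff i 0 = 1 := by
  rcases i with a | s <;> simp [coverCoeff]

theorem coverValue_zero (i : I ⊕ S) : coverValue γ i 0 = 1 := by
  rcases i with a | s
  · exact γ.dpow_zero a.2
  · simp [coverValue]

theorem coverMonomial_mul (m n : (I ⊕ S) →₀ ℕ) : ∃ b : ℕ,
    coverMonomial γ m * coverMonomial γ n = b • coverMonomial γ (m + n) := by
  classical
  choose b hb1 hb2 using cover_mul γ
  set T := m.support ∪ n.support with hT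
  have hadd : (m + n).support ⊆ T := Finsupp.support_add
  refine ⟨∏ i ∈ T, b i (m i) (n i), Prod.ext ?_ ?_⟩
  · simp only [coverMonomial, Prod.fst_mul, Prod.smul_fst, monomial_mul, smul_monomial]
    congr 1
    rw [Finsupp.prod_of_support_subset m (s := T) Finset.subset_union_left _
        (fun i _ => coverCoeff_zero i),
      Finsupp.prod_of_support_subset n (s := T) Finset.subset_union_right _
        (fun i _ => coverCoeff_zero i),
      Finsupp.prod_of_support_subset (m + n) (s := T) hadd _
        (fun i _ => coverCoeff_zero i), ← Finset.prod_mul_distrib, nsmul_eq_mul, Nat.cast_prod,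
      ← Finset.prod_mul_distrib]
    exact Finset.prod_congr rfl fun i _ => hb1 i _ _
  · simp only [coverMonomial, Prod.snd_mul, Prod.smul_snd]
    rw [Finsupp.prod_of_support_subset m (s := T) Finset.subset_union_left _
        (fun i _ => coverValue_zero γ i),
      Finsupp.prod_of_support_subset n (s := T) Finset.subset_union_right _
        (fun i _ => coverValue_zero γ i),
      Finsupp.prod_of_support_subset (m + n) (s := T) hadd _
        (fun i _ => coverValue_zero γ i), ← Finset.prod_mul_distrib, nsmul_eq_mul, Nat.cast_prod,
      ← Finset.prod_mul_distrib]
    exact Finset.prod_congr rfl fun i _ => hb2 i _ _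

/-- The graph of the evaluation of polynomials with divided powers. -/
noncomputable def coverRing : Subring (MvPolynomial (I ⊕ S) ℚ × S) where
  carrier := Submodule.span ℤ (Set.range (coverMonomial γ))
  zero_mem' := Submodule.zero_mem _
  add_mem' := Submodule.add_mem _
  neg_mem' := Submodule.neg_mem _
  one_mem' := Submodule.subset_span ⟨0, by simp [coverMonomial]⟩
  mul_mem' := by
    intro a b ha hb
    induction ha, hb using Submodule.span_induction₂ with
    | mem_mem x y hx hy =>
      obtain ⟨m, rfl⟩ := hx
      obtain ⟨n, rfl⟩ := hy
      obtain ⟨b, hb⟩ := coverMonomial_mul γ m n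
      rw [hb]
      exact nsmul_mem (Submodule.subset_span (Set.mem_range_self (m + n))) b
    | zero_left y hy => simp
    | zero_right x hx => simp
    | add_left x y z _ _ _ h1 h2 => rw [add_mul]; exact Submodule.add_mem _ h1 h2
    | add_right x y z _ _ _ h1 h2 => rw [mul_add]; exact Submodule.add_mem _ h1 h2
    | smul_left r x y _ _ h => rw [smul_mul_assoc]; exact Submodule.smul_mem _ _ h
    | smul_right r x y _ _ h => rw [mul_smul_comm]; exact Submodule.smul_mem _ _ h

theorem mem_coverRing {x : MvPolynomial (I ⊕ S) ℚ × S} :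
    x ∈ coverRing γ ↔ x ∈ Submodule.span ℤ (Set.range (coverMonomial γ)) := Iff.rfl

/-- The first components of the spanning pairs are nonzero rational multiples of distinct monomials,
so they are independent over ℤ. Thus the first component determines the second, and identities over
ℚ can be carried to `S`. -/
theorem snd_eq_zero_of_mem_coverRing {s : S} (h : ((0, s) : MvPolynomial (I ⊕ S) ℚ × S) ∈ coverRing γ) :
    s = 0 := by
  rw [mem_coverRing, Finsupp.mem_span_range_iff_exists_finsupp] at h
  obtain ⟨a, ha⟩ := h
  have h1 : a = 0 := by
    classical
    ext m
    have h2 := congrArg (fun z => coeff m z.1) ha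
    simp only [Finsupp.sum, Prod.fst_sum, coeff_sum, Prod.smul_fst, coverMonomial, coeff_zero,
      coeff_smul] at h2
    rw [Finset.sum_congr rfl fun x _ => by rw [coeff_monomial, smul_ite, smul_zero],
      Finset.sum_ite_eq'] at h2
    by_cases hm : m ∈ a.support
    · rw [if_pos hm, zsmul_eq_mul, mul_eq_zero, Int.cast_eq_zero] at h2
      rcases h2 with h2 | h2
      · exact h2
      · exact absurd h2 (Finset.prod_ne_zero_iff.2 fun i _ => coverCoeff_ne_zero i _)
    · simpa using hm
  simpa [h1] using (congrArg Prod.snd ha).symm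

theorem snd_eq_of_mem_coverRing {q : MvPolynomial (I ⊕ S) ℚ} {s t : S}
    (hs : (q, s) ∈ coverRing γ) (ht : (q, t) ∈ coverRing γ) : s = t := by
  have := (coverRing γ).sub_mem hs ht
  rw [Prod.mk_sub_mk, sub_self] at this
  exact sub_eq_zero.1 (snd_eq_zero_of_mem_coverRing γ this)

theorem X_inr_mem_coverRing (s : S) : (X (Sum.inr s), s) ∈ coverRing γ := by
  refine Submodule.subset_span ⟨Finsupp.single (Sum.inr s) 1, ?_⟩
  refine Prod.ext ?_ ?_
  · simp [coverMonomial, coverCoeff, X]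
  · simp [coverMonomial, coverValue]

theorem X_inl_pow_mem_coverRing (a : I) (n : ℕ) :
    (((n.factorial : ℚ))⁻¹ • X (Sum.inl a) ^ n, γ.dpow n (a : S)) ∈ coverRing γ := by
  refine Submodule.subset_span ⟨Finsupp.single (Sum.inl a) n, ?_⟩
  refine Prod.ext ?_ ?_
  · rw [coverMonomial, Finsupp.prod_single_index (coverCoeff_zero _), X_pow_eq_monomial,
      smul_monomial]
    simp [coverCoeff]
  · simp only [coverMonomial]
    rw [Finsupp.prod_single_index (coverValue_zero γ _)]
    rfl

/-- The ideal of the cover on which divided powers exist. -/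
noncomputable def coverIdeal : Ideal (coverRing γ) where
  carrier := {g | (g : MvPolynomial (I ⊕ S) ℚ × S).2 ∈ I ∧ ∀ k : ℕ,
    (((k.factorial : ℚ))⁻¹ • (g : MvPolynomial (I ⊕ S) ℚ × S).1 ^ k,
      γ.dpow k (g : MvPolynomial (I ⊕ S) ℚ × S).2) ∈ coverRing γ}
  zero_mem' := by
    refine ⟨I.zero_mem, fun k => ?_⟩
    rcases eq_or_ne k 0 with rfl | hk
    · have h1 := (coverRing γ).one_mem
      convert h1 using 1
      simp [γ.dpow_zero I.zero_mem]
    · have h1 := (coverRing γ).zero_mem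
      convert h1 using 1
      simp [γ.dpow_eval_zero hk, zero_pow hk]
  add_mem' := by
    rintro ⟨⟨q, s⟩, hg⟩ ⟨⟨q', s'⟩, hg'⟩ ⟨h1, h2⟩ ⟨h1', h2'⟩
    refine ⟨I.add_mem h1 h1', fun k => ?_⟩
    change (((k.factorial : ℚ))⁻¹ • (q + q') ^ k, γ.dpow k (s + s')) ∈ _
    rw [γ.dpow_add h1 h1']
    convert (coverRing γ).sum_mem (t := Finset.HasAntidiagonal.antidiagonal k) (fun ij (_ : ij ∈ _) =>
      (coverRing γ).mul_mem (h2 ij.1) (h2' ij.2)) using 1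
    refine Prod.ext ?_ ?_
    · simp only [Prod.fst_sum, Prod.fst_mul]
      rw [(Commute.all q q').add_pow', Finset.smul_sum]
      refine Finset.sum_congr rfl fun ij hij => ?_
      rw [Finset.HasAntidiagonal.mem_antidiagonal] at hij
      subst hij
      rw [smul_mul_smul_comm, ← Nat.cast_smul_eq_nsmul ℚ, smul_smul, Nat.cast_add_choose]
      congr 1
      have h0 := Nat.cast_ne_zero (R := ℚ).2 (Nat.factorial_ne_zero (ij.1 + ij.2))
      field_simp
    · simp only [Prod.snd_sum, Prod.snd_mul]
  smul_mem' := by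
    rintro ⟨⟨q, s⟩, hg⟩ ⟨⟨q', s'⟩, hg'⟩ ⟨h1', h2'⟩
    refine ⟨I.mul_mem_left _ h1', fun k => ?_⟩
    change (((k.factorial : ℚ))⁻¹ • (q * q') ^ k, γ.dpow k (s * s')) ∈ _
    convert (coverRing γ).mul_mem ((coverRing γ).pow_mem hg k) (h2' k) using 1
    refine Prod.ext ?_ ?_
    · simp only [Prod.pow_mk, Prod.fst_mul, mul_pow, mul_smul_comm]
    · simp only [Prod.pow_mk, Prod.snd_mul, γ.dpow_mul h1']

theorem X_inl_mem_coverRing (a : I) : (X (Sum.inl a), (a : S)) ∈ coverRing γ := by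
  simpa [γ.dpow_one a.2] using X_inl_pow_mem_coverRing γ a 1

theorem X_inl_mem_coverIdeal (a : I) :
    (⟨_, X_inl_mem_coverRing γ a⟩ : coverRing γ) ∈ coverIdeal γ :=
  ⟨a.2, fun k => X_inl_pow_mem_coverRing γ a k⟩

/-- The projection of the cover to polynomials. -/
noncomputable def coverFst : coverRing γ →+* MvPolynomial (I ⊕ S) ℚ :=
  (RingHom.fst _ _).comp (coverRing γ).subtype

/-- The projection of the cover to the ring that it covers. -/
noncomputable def coverSnd : coverRing γ →+* S :=
  (RingHom.snd _ _).comp (coverRing γ).subtype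

end Cover

/-! ### Witt vectors with components in an ideal, and ghost components -/

namespace WittVector

theorem coeff_mem_iff {p : ℕ} [Fact p.Prime] {A : Type*} [CommRing A] {K : Ideal A}
    {x : WittVector p A} :
    (∀ n, x.coeff n ∈ K) ↔ x ∈ RingHom.ker (WittVector.map (p := p) (Ideal.Quotient.mk K)) := by
  rw [RingHom.mem_ker, WittVector.ext_iff]
  refine forall_congr' fun n => ?_
  rw [map_coeff, zero_coeff, Ideal.Quotient.eq_zero_iff_mem]

theorem ghostComponent_eq_sum {p : ℕ} [Fact p.Prime] {A : Type*} [CommRing A]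
    (x : WittVector p A) (n : ℕ) :
    ghostComponent n x = ∑ i ∈ Finset.range (n + 1), (p : A) ^ i * x.coeff i ^ p ^ (n - i) := by
  rw [ghostComponent_apply, aeval_wittPolynomial]

theorem ghostComponent_map {p : ℕ} [Fact p.Prime] {A B : Type*} [CommRing A] [CommRing B]
    (f : A →+* B) (x : WittVector p A) (n : ℕ) :
    ghostComponent n (map f x) = f (ghostComponent n x) := by
  simp [ghostComponent_eq_sum]

end WittVector

/-! ### Logarithmic coordinates -/

section LogCoord

open MvPolynomial WittVector

variable (p : ℕ) [hp : Fact p.Prime] {S : Type u} [CommRing S] {I : Ideal S} (γ : DividedPowers I)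

/-- Over ℚ, the coefficient p^i / p^n of the i-th term of the ghost component equals (p^(n-i) - 1)!
/ (p^(n-i))!. So the ghost component divided by p^n is the divided Witt polynomial. -/
theorem ghost_logCoord_mem_coverRing {z : WittVector p (coverRing γ)}
    (hz : ∀ n, z.coeff n ∈ coverIdeal γ) (n : ℕ) :
    (((p : ℚ) ^ n)⁻¹ • ghostComponent n (WittVector.map (coverFst γ) z),
      logCoord p γ (WittVector.map (coverSnd γ) z) n) ∈ coverRing γ := by
  have hp0 : (p : ℚ) ≠ 0 := Nat.cast_ne_zero.2 hp.out.ne_zero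
  convert (coverRing γ).sum_mem (t := Finset.range (n + 1)) (fun i _ =>
    (coverRing γ).mul_mem (natCast_mem (coverRing γ) (p ^ (n - i) - 1).factorial)
      ((hz i).2 (p ^ (n - i)))) using 1
  refine Prod.ext ?_ ?_
  · simp only [Prod.fst_sum, Prod.fst_mul, ghostComponent_eq_sum, Finset.smul_sum]
    refine Finset.sum_congr rfl fun i hi => ?_
    have hi : i ≤ n := Nat.lt_succ_iff.1 (Finset.mem_range.1 hi)
    have h1 : ((p ^ (n - i)).factorial : ℚ) = (p : ℚ) ^ (n - i) * (p ^ (n - i) - 1).factorial := by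
      rw [← Nat.mul_factorial_pred (pow_ne_zero _ hp.out.ne_zero)]
      push_cast
      rfl
    have h2 : ((p ^ (n - i) - 1).factorial : ℚ) ≠ 0 := Nat.cast_ne_zero.2 (Nat.factorial_ne_zero _)
    have h3 : (p : ℚ) ^ n = (p : ℚ) ^ i * (p : ℚ) ^ (n - i) := by
      rw [← pow_add, Nat.add_sub_cancel' hi]
    change ((p : ℚ) ^ n)⁻¹ • ((p : MvPolynomial (I ⊕ S) ℚ) ^ i * _) =
      ((p ^ (n - i) - 1).factorial : MvPolynomial (I ⊕ S) ℚ) * _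
    rw [← Nat.cast_pow p i, ← nsmul_eq_mul, ← nsmul_eq_mul, ← Nat.cast_smul_eq_nsmul ℚ,
      ← Nat.cast_smul_eq_nsmul ℚ, smul_smul, smul_smul, h1, h3, WittVector.map_coeff]
    have h4 : (((p : ℚ) ^ i * (p : ℚ) ^ (n - i))⁻¹ * ((p ^ i : ℕ) : ℚ)) =
        ((p ^ (n - i) - 1).factorial : ℚ) *
          ((p : ℚ) ^ (n - i) * ((p ^ (n - i) - 1).factorial : ℚ))⁻¹ := by
      push_cast
      field_simp
    rw [h4]
    rfl
  · simp only [Prod.snd_sum, Prod.snd_mul, logCoord]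
    rfl

theorem exists_cover (x : WittVector p S) :
    ∃ z : WittVector p (coverRing γ), WittVector.map (coverSnd γ) z = x :=
  WittVector.map_surjective _ (fun s => ⟨⟨_, X_inr_mem_coverRing γ s⟩, rfl⟩) x

theorem exists_cover_mem {x : WittVector p S} (hx : ∀ n, x.coeff n ∈ I) :
    ∃ z : WittVector p (coverRing γ), (∀ n, z.coeff n ∈ coverIdeal γ) ∧
      WittVector.map (coverSnd γ) z = x :=
  ⟨WittVector.mk p fun n => ⟨_, X_inl_mem_coverRing γ ⟨x.coeff n, hx n⟩⟩,
    fun n => X_inl_mem_coverIdeal γ ⟨x.coeff n, hx n⟩, by ext n; rfl⟩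

/-- Logarithmic coordinates are additive. -/
theorem logCoord_add {x y : WittVector p S} (hx : ∀ n, x.coeff n ∈ I) (hy : ∀ n, y.coeff n ∈ I)
    (n : ℕ) : logCoord p γ (x + y) n = logCoord p γ x n + logCoord p γ y n := by
  obtain ⟨x, hx', rfl⟩ := exists_cover_mem p γ hx
  obtain ⟨y, hy', rfl⟩ := exists_cover_mem p γ hy
  have hxy : ∀ n, (x + y).coeff n ∈ coverIdeal γ :=
    coeff_mem_iff.2 (Ideal.add_mem _ (coeff_mem_iff.1 hx') (coeff_mem_iff.1 hy'))
  -- `h1` and `h2` are pairs with the same first component, because ghost components are additive;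
  -- so their second components agree.
  have h1 := ghost_logCoord_mem_coverRing p γ hxy n
  have h2 := (coverRing γ).add_mem (ghost_logCoord_mem_coverRing p γ hx' n)
    (ghost_logCoord_mem_coverRing p γ hy' n)
  rw [Prod.mk_add_mk, ← smul_add, ← map_add, ← map_add] at h2
  rw [← map_add]
  exact snd_eq_of_mem_coverRing γ h1 h2

/-- Logarithmic coordinates are linear over the ghost components. -/
theorem logCoord_mul (w : WittVector p S) {x : WittVector p S} (hx : ∀ n, x.coeff n ∈ I)
    (n : ℕ) : logCoord p γ (w * x) n = ghostComponent n w * logCoord p γ x n := by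
  obtain ⟨x, hx', rfl⟩ := exists_cover_mem p γ hx
  obtain ⟨w, rfl⟩ := exists_cover p γ w
  have hxy : ∀ n, (w * x).coeff n ∈ coverIdeal γ :=
    coeff_mem_iff.2 (Ideal.mul_mem_left _ _ (coeff_mem_iff.1 hx'))
  have h1 := ghost_logCoord_mem_coverRing p γ hxy n
  have h2 := (coverRing γ).mul_mem (ghostComponent n w).2
    (ghost_logCoord_mem_coverRing p γ hx' n)
  rw [ghostComponent_map, ← map_mul]
  refine snd_eq_of_mem_coverRing γ h1 ?_
  convert h2 using 1
  refine Prod.ext ?_ rfl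
  simp only [map_mul, Prod.fst_mul, mul_smul_comm, ghostComponent_map]
  rfl

theorem logCoord_verschiebung (x : WittVector p S) (n : ℕ) :
    logCoord p γ (verschiebung x) (n + 1) = logCoord p γ x n := by
  rw [logCoord, Finset.sum_range_succ', logCoord, verschiebung_coeff_zero,
    γ.dpow_eval_zero (pow_ne_zero _ hp.out.ne_zero), mul_zero, add_zero]
  refine Finset.sum_congr rfl fun i _ => ?_
  rw [verschiebung_coeff_succ, Nat.add_sub_add_right]

/-- The components of the Witt vector with given logarithmic coordinates. -/
noncomputable def ofLogCoeff (a : ℕ → S) : ℕ → S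
  | 0 => a 0
  | n + 1 => a (n + 1) - ∑ i : Fin (n + 1), ((p ^ (n + 1 - (i : ℕ)) - 1).factorial : S) *
      γ.dpow (p ^ (n + 1 - (i : ℕ))) (ofLogCoeff a i)

/-- The n-th coordinate is the n-th component plus terms in the earlier components, so the
components can be solved for recursively. -/
theorem exists_logCoord_eq {a : ℕ → S} (ha : ∀ n, a n ∈ I) :
    ∃ x : WittVector p S, (∀ n, x.coeff n ∈ I) ∧ ∀ n, logCoord p γ x n = a n := by
  have hmem : ∀ n, ofLogCoeff p γ a n ∈ I := by
    intro n
    induction n using Nat.strong_induction_on with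
    | _ n ih =>
      cases n with
      | zero => simpa [ofLogCoeff] using ha 0
      | succ n =>
        rw [ofLogCoeff]
        refine I.sub_mem (ha _) (I.sum_mem fun i _ => I.mul_mem_left _ (γ.dpow_mem ?_ (ih i i.2)))
        exact pow_ne_zero _ hp.out.ne_zero
  refine ⟨WittVector.mk p (ofLogCoeff p γ a), hmem, fun n => ?_⟩
  rw [logCoord, Finset.sum_range_succ, Nat.sub_self, pow_zero, Nat.sub_self, Nat.factorial_zero,
    Nat.cast_one, one_mul, coeff_mk, γ.dpow_one (hmem n)]
  cases n with
  | zero => simp [ofLogCoeff]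
  | succ n =>
    conv_lhs => rw [ofLogCoeff]
    rw [Finset.sum_range]
    exact add_sub_cancel _ _

theorem logCoord_sum {T : Type*} (s : Finset T) {x : T → WittVector p S}
    (hx : ∀ t ∈ s, ∀ n, (x t).coeff n ∈ I) (n : ℕ) :
    logCoord p γ (∑ t ∈ s, x t) n = ∑ t ∈ s, logCoord p γ (x t) n := by
  classical
  induction s using Finset.induction_on with
  | empty =>
    have h0 : ∀ n, (0 : WittVector p S).coeff n ∈ I := fun n => by simp
    have h := logCoord_add p γ h0 h0 n
    rw [add_zero] at h
    simpa using h
  | insert t s ht ih =>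
    have h1 : ∀ n, (∑ t ∈ s, x t).coeff n ∈ I := coeff_mem_iff.2
      (Ideal.sum_mem _ fun t ht => coeff_mem_iff.1 (hx t (Finset.mem_insert_of_mem ht)))
    rw [Finset.sum_insert ht, Finset.sum_insert ht,
      logCoord_add p γ (hx t (Finset.mem_insert_self t s)) h1,
      ih fun t ht => hx t (Finset.mem_insert_of_mem ht)]

/-- The ghost components of an integer `k` are all `k`, so `k` acts on W(𝔞) as on a product of
copies of 𝔞. -/
theorem natCast_mul_eq_zero_of_coeff_mem (γ : DividedPowers I) {k : ℕ} (hk : (k : S) = 0) {x : WittVector p S}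
    (hx : ∀ n, x.coeff n ∈ I) : (k : WittVector p S) * x = 0 := by
  have h0 : ∀ n, (0 : WittVector p S).coeff n ∈ I := fun n => by simp
  refine eq_of_logCoord_eq p γ (coeff_mem_iff.2 (Ideal.mul_mem_left _ _ (coeff_mem_iff.1 hx))) h0
    fun n => ?_
  -- Writing 0 as 0 * 0 lets `logCoord_mul` show that its coordinates vanish.
  rw [← zero_mul (0 : WittVector p S), logCoord_mul p γ _ hx, logCoord_mul p γ _ h0, map_natCast, hk,
    map_zero, zero_mul, zero_mul]

end LogCoord

/-! ### The Jacobson radical of W(S) when p is nilpotent in S -/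

namespace WittVector

variable {p : ℕ} [hp : Fact p.Prime] {S : Type*} [CommRing S]

/-- Inverses are unique, so the inverses of the truncations are compatible and glue; an identity
that holds in all truncations holds in W(S). -/
theorem isUnit_of_isUnit_truncate {x : WittVector p S} (h : ∀ n, IsUnit (truncate n x)) :
    IsUnit x := by
  have h1 : ∀ n, ∃ z : WittVector p S, truncate n z * truncate n x = 1 := by
    intro n
    obtain ⟨t, ht⟩ := (h n).exists_left_inv
    obtain ⟨z, rfl⟩ := truncate_surjective p n S t
    exact ⟨z, ht⟩
  choose z hz using h1
  have hz' : ∀ m n, m ≤ n → truncate m (z n) = truncate m (z m) := by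
    intro m n hmn
    refine (h m).mul_right_cancel ?_
    rw [hz m, ← TruncatedWittVector.truncate_wittVector_truncate hmn,
      ← TruncatedWittVector.truncate_wittVector_truncate hmn, ← map_mul, hz n, map_one]
  have hc : ∀ n, truncate n (WittVector.mk p fun n => (z (n + 1)).coeff n) = truncate n (z n) := by
    intro n
    ext i
    rw [coeff_truncate, coeff_truncate, coeff_mk]
    have := congrArg (TruncatedWittVector.coeff (Fin.last (i : ℕ))) (hz' (i + 1) n i.2)
    rw [coeff_truncate, coeff_truncate] at this
    exact this.symm
  refine IsUnit.of_mul_eq_one_right (WittVector.mk p fun n => (z (n + 1)).coeff n) ?_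
  rw [← sub_eq_zero]
  have : (WittVector.mk p fun n => (z (n + 1)).coeff n) * x - 1 ∈
      (⨅ i : ℕ, RingHom.ker (truncate (p := p) (R := S) i)) := by
    rw [Ideal.mem_iInf]
    intro n
    rw [RingHom.mem_ker, map_sub, map_mul, hc, hz, map_one, sub_self]
  rwa [TruncatedWittVector.iInf_ker_truncate] at this

theorem constantCoeff_frobenius (x : WittVector p S) :
    constantCoeff (frobenius x) = x.coeff 0 ^ p + p * x.coeff 1 := by
  have h := ghostComponent_frobenius 0 x
  rw [ghostComponent_eq_sum, ghostComponent_eq_sum] at h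
  simpa [Finset.sum_range_succ] using h

/-- Write a = V^(n+1) b. Then a x^k = V^(n+1)(b σ^(n+1)(x^k)). Since x lies in the image of V, σ(x)
is a multiple of p, so σ^(n+1)(x^k) is a multiple of p^k and has first component zero. -/
theorem coeff_mul_pow_eq_zero {k : ℕ} (hk : (p : S) ^ k = 0) {x a : WittVector p S}
    (hx : x.coeff 0 = 0) {n : ℕ} (ha : ∀ i < n + 1, a.coeff i = 0) :
    ∀ i < n + 2, (a * x ^ k).coeff i = 0 := by
  have h1 := eq_iterate_verschiebung ha
  set b := a.shift (n + 1)
  have h2 : a * x ^ k = verschiebung^[n + 1] (b * frobenius^[n + 1] (x ^ k)) := by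
    conv_lhs => rw [h1]
    rw [iterate_verschiebung_mul_left]
  intro i hi
  rw [h2]
  rcases Nat.lt_succ_iff_lt_or_eq.1 hi with hi | rfl
  · exact iterate_verschiebung_coeff_eq_zero _ hi
  · have h3 := iterate_verschiebung_coeff (b * frobenius^[n + 1] (x ^ k)) (n + 1) 0
    rw [zero_add] at h3
    rw [h3, mul_coeff_zero]
    have h4 : frobenius^[n + 1] (x ^ k) = (frobenius^[n] (frobenius x)) ^ k := by
      rw [← Function.iterate_succ_apply, iterate_map_pow]
    have h5 : frobenius x = x.shift 1 * p := by
      rw [← frobenius_verschiebung, verschiebung_shift x 0 (by simpa using hx)]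
      congr 1
      ext n
      rw [shift_coeff, zero_add]
    have h6 : ∃ y, frobenius^[n] (frobenius x) = y * p := by
      refine ⟨frobenius^[n] (x.shift 1), ?_⟩
      rw [h5, iterate_map_mul]
      congr 1
      exact Function.iterate_fixed (map_natCast frobenius p) n
    obtain ⟨y, hy⟩ := h6
    rw [h4, hy, mul_pow]
    change _ * constantCoeff (y ^ k * (p : WittVector p S) ^ k) = 0
    rw [map_mul, map_pow constantCoeff (p : WittVector p S), map_natCast, hk, mul_zero, mul_zero]

theorem isNilpotent_truncate (hS : IsNilpotent (p : S)) {x : WittVector p S}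
    (hx : x.coeff 0 = 0) (n : ℕ) : IsNilpotent (truncate n x) := by
  obtain ⟨k, hk⟩ := hS
  have key : ∀ n, ∃ m, ∀ i < n + 1, (x ^ m).coeff i = 0 := by
    intro n
    induction n with
    | zero => exact ⟨1, by simpa using hx⟩
    | succ n ih =>
      obtain ⟨m, hm⟩ := ih
      exact ⟨m + k, by rw [pow_add]; exact coeff_mul_pow_eq_zero hk hx hm⟩
  obtain ⟨m, hm⟩ := key n
  refine ⟨m, ?_⟩
  rw [← map_pow, ← RingHom.mem_ker, mem_ker_truncate]
  exact fun i hi => hm i (hi.trans (Nat.lt_succ_self n))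

/-- A power x^m has first component zero, hence 1 + x^m y is a unit in every truncation and so a
unit. The Jacobson radical is a radical ideal. -/
theorem mem_jacobson_of_isNilpotent (hS : IsNilpotent (p : S)) {x : WittVector p S}
    (hx : IsNilpotent (constantCoeff x)) : x ∈ Ideal.jacobson (⊥ : Ideal (WittVector p S)) := by
  obtain ⟨m, hm⟩ := hx
  rw [← map_pow] at hm
  have h1 : x ^ m ∈ Ideal.jacobson (⊥ : Ideal (WittVector p S)) := by
    rw [Ideal.mem_jacobson_bot]
    intro y
    refine isUnit_of_isUnit_truncate fun n => ?_
    rw [map_add, map_one]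
    refine (isNilpotent_truncate hS ?_ n).isUnit_add_one
    change constantCoeff (x ^ m * y) = 0
    rw [map_mul, hm, zero_mul]
  exact Ideal.isRadical_jacobson _ ⟨m, h1⟩

theorem natCast_mem_jacobson (hS : IsNilpotent (p : S)) :
    (p : WittVector p S) ∈ Ideal.jacobson (⊥ : Ideal (WittVector p S)) :=
  mem_jacobson_of_isNilpotent hS (by rwa [map_natCast])

theorem frobenius_sub_pow_mem_jacobson (hS : IsNilpotent (p : S)) (x : WittVector p S) :
    frobenius x - x ^ p ∈ Ideal.jacobson (⊥ : Ideal (WittVector p S)) := by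
  refine mem_jacobson_of_isNilpotent hS ?_
  rw [map_sub, constantCoeff_frobenius, map_pow]
  change IsNilpotent (x.coeff 0 ^ p + p * x.coeff 1 - x.coeff 0 ^ p)
  rw [add_sub_cancel_left]
  exact (Commute.all _ _).isNilpotent_mul_right hS

end WittVector

/-! ### Infinite systems of linear equations over artinian modules -/

/-- In a sequence of endomorphisms of an artinian module, the equations
`β n = ε n + u n (β (n + 1))` have a solution. -/
theorem exists_forall_eq_add_of_isArtinian {S N : Type*} [Ring S] [AddCommGroup N] [Module S N]
    [IsArtinian S N] (u : ℕ → N →ₗ[S] N) (ε : ℕ → N) :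
    ∃ β : ℕ → N, ∀ n, β n = ε n + u n (β (n + 1)) := by
  -- `sol m n b`: there are `m` further terms after `b` in position `n`
  let sol : ℕ → ℕ → Set N := fun m => Nat.rec (fun _ => Set.univ)
    (fun _ A n => (fun b => ε n + u n b) '' A (n + 1)) m
  let im : ℕ → ℕ → Submodule S N := fun m => Nat.rec (fun _ => ⊤)
    (fun _ A n => (A (n + 1)).map (u n)) m
  have sol_succ : ∀ m n, sol (m + 1) n = (fun b => ε n + u n b) '' sol m (n + 1) := fun _ _ => rfl
  have im_succ : ∀ m n, im (m + 1) n = (im m (n + 1)).map (u n) := fun _ _ => rfl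
  -- Each `sol m n` is a coset of `im m n`. The descending chain condition on submodules therefore
  -- passes to the solution sets.
  have sol_sub : ∀ m n, ∀ a ∈ sol m n, ∀ b, b ∈ sol m n ↔ b - a ∈ im m n := by
    intro m
    induction m with
    | zero => exact fun n a _ b => ⟨fun _ => trivial, fun _ => trivial⟩
    | succ m ih =>
      intro n a ha b
      obtain ⟨a, ha, rfl⟩ := ha
      rw [im_succ, Submodule.mem_map]
      constructor
      · rintro ⟨b, hb, rfl⟩
        exact ⟨b - a, (ih _ a ha b).1 hb, by simp⟩
      · rintro ⟨c, hc, h⟩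
        refine ⟨a + c, (ih _ a ha _).2 (by simpa using hc), ?_⟩
        simp only [map_add, h]
        abel
  have sol_anti : ∀ n, Antitone fun m => sol m n := by
    intro n
    refine antitone_nat_of_succ_le fun m => ?_
    induction m generalizing n with
    | zero => exact Set.subset_univ _
    | succ m ih => rw [sol_succ (m + 1), sol_succ m]; exact Set.image_mono (ih (n + 1))
  have im_anti : ∀ n, Antitone fun m => im m n := by
    intro n
    refine antitone_nat_of_succ_le fun m => ?_
    induction m generalizing n with
    | zero => exact le_top
    | succ m ih => rw [im_succ (m + 1), im_succ m]; exact Submodule.map_mono (ih (n + 1))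
  have sol_ne : ∀ m n, (sol m n).Nonempty := by
    intro m
    induction m with
    | zero => exact fun n => ⟨0, trivial⟩
    | succ m ih => exact fun n => (ih (n + 1)).image _
  have sol_stab : ∀ n, ∃ m₀, ∀ m, m₀ ≤ m → sol m n = sol m₀ n := by
    intro n
    obtain ⟨m₀, h⟩ := IsArtinian.monotone_stabilizes (R := S) (M := N)
      ⟨fun m => OrderDual.toDual (im m n), fun a b hab => im_anti n hab⟩
    refine ⟨m₀, fun m hm => ?_⟩
    obtain ⟨a, ha⟩ := sol_ne m n
    ext b
    rw [sol_sub m n a ha, sol_sub m₀ n a (sol_anti n hm ha)]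
    have : im m₀ n = im m n := h m hm
    rw [this]
  let lim : ℕ → Set N := fun n => ⋂ m, sol m n
  have lim_ne : (lim 0).Nonempty := by
    obtain ⟨m₀, h⟩ := sol_stab 0
    obtain ⟨a, ha⟩ := sol_ne m₀ 0
    refine ⟨a, Set.mem_iInter.2 fun m => ?_⟩
    rcases le_total m₀ m with hm | hm
    · rwa [h m hm]
    · exact sol_anti 0 hm ha
  -- Choose `m₀` where the solution sets in position n + 1 are stable. A predecessor taken from `sol
  -- m₀ (n + 1)` then lies in all of them.
  have step : ∀ n, ∀ a ∈ lim n, ∃ b ∈ lim (n + 1), a = ε n + u n b := by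
    intro n a ha
    obtain ⟨m₀, h⟩ := sol_stab (n + 1)
    obtain ⟨b, hb, rfl⟩ := Set.mem_iInter.1 ha (m₀ + 1)
    refine ⟨b, Set.mem_iInter.2 fun m => ?_, rfl⟩
    rcases le_total m₀ m with hm | hm
    · rwa [h m hm]
    · exact sol_anti _ hm hb
  choose! g hg1 hg2 using step
  obtain ⟨a, ha⟩ := lim_ne
  let β : ℕ → N := fun n => Nat.rec a (fun n b => g n b) n
  have hβ : ∀ n, β n ∈ lim n := by
    intro n
    induction n with
    | zero => exact ha
    | succ n ih => exact hg1 n _ ih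
  exact ⟨β, fun n => hg2 n _ (hβ n)⟩

/-! ### Linearization of semilinear maps -/

section Twist

variable {W : Type u} [CommRing W] (f : W →+* W) {M N : Type u} [AddCommGroup M] [Module W M]
  [AddCommGroup N] [Module W N]

theorem Twist.induction_on {f : W →+* W} {C : Twist f M → Prop} (z : Twist f M)
    (h0 : C 0) (h1 : ∀ a x, C (Twist.tmul f a x)) (h2 : ∀ y z, C y → C z → C (y + z)) : C z :=
  TensorProduct.induction_on (R := W) (M := TwistRing f) (N := M) z h0 h1 h2

/-- The linearization of a semilinear map, as an additive map. -/
noncomputable def Twist.liftAddHom {f : W →+* W} (φ : M →ₛₗ[f] N) : Twist f M →+ N :=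
  TensorProduct.liftAddHom (R := W) (M := TwistRing f) (N := M)
    { toFun := fun a => (DistribSMul.toAddMonoidHom N (show W from a)).comp φ.toAddMonoidHom
      map_zero' := by ext x; exact zero_smul W (φ x)
      map_add' := fun a b => by ext x; exact add_smul (show W from a) (show W from b) (φ x) }
    (fun r a x => by
      change (f r * (show W from a)) • φ x = (show W from a) • φ (r • x)
      rw [LinearMap.map_smulₛₗ, smul_smul, mul_comm])

theorem Twist.liftAddHom_tmul {f : W →+* W} (φ : M →ₛₗ[f] N) (a : W) (x : M) :
    Twist.liftAddHom φ (Twist.tmul f a x) = a • φ x := rfl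

/-- The linearization of a semilinear map. -/
noncomputable def Twist.lift {f : W →+* W} (φ : M →ₛₗ[f] N) : Twist f M →ₗ[W] N where
  toFun := Twist.liftAddHom φ
  map_add' := map_add _
  map_smul' := by
    intro b z
    induction z using Twist.induction_on with
    | h0 => rw [smul_zero, map_zero, smul_zero]
    | h1 a x =>
      rw [Twist.smul_tmul, Twist.liftAddHom_tmul, Twist.liftAddHom_tmul, mul_smul]
      rfl
    | h2 y z hy hz =>
      rw [smul_add, map_add, hy, hz, map_add, smul_add]

theorem Twist.lift_tmul {f : W →+* W} (φ : M →ₛₗ[f] N) (a : W) (x : M) :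
    Twist.lift φ (Twist.tmul f a x) = a • φ x := rfl

instance [Module.Finite W M] : Module.Finite W (Twist f M) :=
  inferInstanceAs (Module.Finite (TwistRing f) (TwistRing f ⊗[W] M))

instance [Module.Projective W M] : Module.Projective W (Twist f M) :=
  inferInstanceAs (Module.Projective (TwistRing f) (TwistRing f ⊗[W] M))

theorem Twist.rankAtStalk [Module.Finite W M] [Module.Projective W M] (q : PrimeSpectrum W) :
    Module.rankAtStalk (Twist f M) q = Module.rankAtStalk M (q.comap f) := by
  let q' : PrimeSpectrum (TwistRing f) := q
  exact Module.rankAtStalk_baseChange (R := W) (M := M) q'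

/-- Let `f` be congruent to the `p`-th power map modulo the Jacobson radical. Then every surjective
linear map `W ⊗_{f, W} M → M` is bijective. -/
theorem Twist.bijective_of_surjective {p : ℕ} (hp : p ≠ 0)
    (hf : ∀ x, f x - x ^ p ∈ Ideal.jacobson (⊥ : Ideal W)) [Module.Finite W M]
    [Module.Projective W M] {g : Twist f M →ₗ[W] M} (hg : Function.Surjective g) :
    Function.Bijective g := by
  -- A surjection of finite projective modules is bijective if the ranks at maximal ideals agree.
  -- The rank of the twist at `m` is that of `M` at the preimage of `m` under `f`, and this preimage
  -- is `m` because f x ≡ x^p modulo `m`.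
  refine Module.bijective_of_surjective_of_rankAtStalk_eq hg fun m hm => ?_
  rw [Twist.rankAtStalk]
  congr 1
  ext x
  change f x ∈ m ↔ x ∈ m
  have h1 : f x - x ^ p ∈ m := by
    have := hf x
    rw [Ideal.jacobson, Submodule.mem_sInf] at this
    exact this m ⟨bot_le, hm⟩
  refine Iff.trans ?_ (hm.isPrime.pow_mem_iff_mem (r := x) p (Nat.pos_of_ne_zero hp))
  exact ⟨fun h => by simpa using m.sub_mem h h1, fun h => by simpa using m.add_mem h1 h⟩

end Twist

/-- A module over `A` that is annihilated by the kernel of a surjection `A → B` is a module over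
`B`. -/
theorem exists_module_of_surjective {A B : Type*} [CommRing A] [CommRing B] {f : A →+* B}
    (hf : Function.Surjective f) {M : Type*} [AddCommGroup M] [Module A M]
    (hM : ∀ a ∈ RingHom.ker f, ∀ x : M, a • x = 0) :
    ∃ _ : Module B M, ∀ (a : A) (x : M), f a • x = a • x := by
  let g : A →+* (AddMonoid.End M) := Module.toAddMonoidEnd A M
  have hg : RingHom.ker f ≤ RingHom.ker g := by
    intro a ha
    rw [RingHom.mem_ker]
    ext x
    exact hM a ha x
  let h : B →+* AddMonoid.End M := f.liftOfRightInverse (Function.surjInv hf)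
    (Function.rightInverse_surjInv hf) ⟨g, hg⟩
  refine ⟨Module.compHom M h, fun a x => ?_⟩
  change h (f a) x = g a x
  rw [f.liftOfRightInverse_comp_apply]

/-! ### Approximate normal decompositions and the universal property of displays -/

namespace FrameDisplay

variable {W R : Type u} [CommRing W] [CommRing R] {π : W →+* R} {σ : W →+* W}
  {σd : RingHom.ker π → W} (D : FrameDisplay π σ σd)

theorem map_F_of_mem {p : ℕ} {v : RingHom.ker π} (hv : σd v = 1) (hσv : σ v = p) (y : D.Q) :
    D.F y = (p : W) • D.Fdot y := by
  have h1 := D.Fdot_smul v y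
  rw [hv, one_smul] at h1
  rw [← h1, ← hσv, ← LinearMap.map_smulₛₗ]
  rfl

/-- A lift of a projection along `Q / J P`. -/
theorem exists_approx_projection (hπ : Function.Surjective π) :
    ∃ f : D.P →ₗ[W] D.P, (∀ x, x - f x ∈ D.Q) ∧
      ∀ y ∈ D.Q, f y ∈ RingHom.ker π • (⊤ : Submodule W D.P) := by
  set J := RingHom.ker π
  obtain ⟨m, hm, hproj⟩ := D.quot_projective
  have hJ : J • (⊤ : Submodule W D.P) ≤ D.Q := Submodule.smul_le.2 fun a ha x _ => D.smul_mem a ha x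
  obtain ⟨m', hm'⟩ := exists_module_of_surjective hπ (M := D.P ⧸ (J • (⊤ : Submodule W D.P)))
    (by
      intro a ha x
      obtain ⟨x, rfl⟩ := Submodule.Quotient.mk_surjective _ x
      rw [← Submodule.Quotient.mk_smul, Submodule.Quotient.mk_eq_zero]
      exact Submodule.smul_mem_smul ha trivial)
  let q : (D.P ⧸ (J • (⊤ : Submodule W D.P))) →ₗ[W] (D.P ⧸ D.Q) := Submodule.factor hJ
  let q' : (D.P ⧸ (J • (⊤ : Submodule W D.P))) →ₗ[R] (D.P ⧸ D.Q) :=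
    { q with
      map_smul' := by
        intro r x
        obtain ⟨w, rfl⟩ := hπ r
        change q (π w • x) = π w • q x
        rw [hm', hm, map_smul] }
  have hq' : Function.Surjective q' := by
    intro x
    obtain ⟨x, rfl⟩ := Submodule.Quotient.mk_surjective _ x
    exact ⟨Submodule.Quotient.mk x, rfl⟩
  -- `s` is an `R`-linear section of P/JP → P/Q. The composite P → P/Q → P/JP then lifts to an
  -- endomorphism of the projective module P.
  obtain ⟨s, hs⟩ := Module.projective_lifting_property q' LinearMap.id hq'
  let t : D.P →ₗ[W] D.P ⧸ (J • (⊤ : Submodule W D.P)) :=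
    { toFun := fun x => s (Submodule.Quotient.mk x)
      map_add' := fun x y => by rw [Submodule.Quotient.mk_add, map_add]
      map_smul' := fun w x => by
        rw [Submodule.Quotient.mk_smul, ← hm, map_smul, hm']
        rfl }
  have := D.projective
  obtain ⟨f, hf⟩ := Module.projective_lifting_property (Submodule.mkQ (J • (⊤ : Submodule W D.P))) t
    (Submodule.mkQ_surjective _)
  have hf' : ∀ x, Submodule.Quotient.mk (f x) = s (Submodule.Quotient.mk x) :=
    fun x => LinearMap.congr_fun hf x
  refine ⟨f, fun x => ?_, fun y hy => ?_⟩
  · rw [← Submodule.Quotient.mk_eq_zero, Submodule.Quotient.mk_sub, sub_eq_zero]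
    have h1 := LinearMap.congr_fun hs (Submodule.Quotient.mk x)
    change q (s (Submodule.Quotient.mk x)) = Submodule.Quotient.mk x at h1
    rw [← hf'] at h1
    exact h1.symm
  · rw [← Submodule.Quotient.mk_eq_zero, hf', (Submodule.Quotient.mk_eq_zero _).2 hy, map_zero]

/-- A lift of a projection along `Q / J P` that is idempotent modulo `J ^ 2`. -/
theorem exists_projection (hπ : Function.Surjective π) :
    ∃ f : D.P →ₗ[W] D.P, (∀ x, x - f x ∈ D.Q) ∧
      (∀ y ∈ D.Q, f y ∈ RingHom.ker π • (⊤ : Submodule W D.P)) ∧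
      ∀ x, f x - f (f x) ∈ RingHom.ker π • (RingHom.ker π • (⊤ : Submodule W D.P)) := by
  obtain ⟨f, h1, h2⟩ := D.exists_approx_projection hπ
  set J := RingHom.ker π
  have hsmul : ∀ (g : D.P →ₗ[W] D.P) (K : Submodule W D.P), ∀ x ∈ J • K, g x ∈ J • K.map g := by
    intro g K x hx
    rw [← Submodule.map_smul'']
    exact Submodule.mem_map_of_mem hx
  have hJ : ∀ (g : D.P →ₗ[W] D.P) , ∀ x ∈ J • (⊤ : Submodule W D.P),
      g x ∈ J • (⊤ : Submodule W D.P) := fun g x hx =>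
    Submodule.smul_mono le_rfl le_top (hsmul g ⊤ x hx)
  let e : D.P →ₗ[W] D.P := f - f ∘ₗ f
  have he : ∀ x, e x ∈ J • (⊤ : Submodule W D.P) := by
    intro x
    change f x - f (f x) ∈ _
    rw [← map_sub]
    exact h2 _ (h1 x)
  have hee : ∀ x, e (e x) ∈ J • (J • (⊤ : Submodule W D.P)) := by
    intro x
    refine Submodule.smul_mono le_rfl ?_ (hsmul e ⊤ _ (he x))
    rintro _ ⟨y, -, rfl⟩
    exact he y
  -- The polynomial 3f² - 2f³ is the usual improvement of an approximate idempotent: 1 - g = (1 -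
  -- f)²(1 + 2f), and g - g² = e²(3 + 4e) with e = f - f².
  let g : D.P →ₗ[W] D.P := (3 : W) • (f ∘ₗ f) - (2 : W) • (f ∘ₗ f ∘ₗ f)
  have hg : ∀ x, g x = (3 : W) • f (f x) - (2 : W) • f (f (f x)) := fun _ => rfl
  refine ⟨g, fun x => ?_, fun y hy => ?_, fun x => ?_⟩
  · have h3 : x - g x = (x + (2 : W) • f x) - f (x + (2 : W) • f x) -
        (f (x + (2 : W) • f x) - f (f (x + (2 : W) • f x))) := by
      rw [hg]
      simp only [map_add, map_smul]
      module
    rw [h3]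
    exact D.Q.sub_mem (h1 _) (h1 _)
  · rw [hg]
    exact Submodule.sub_mem _ (Submodule.smul_mem _ _ (hJ _ _ (h2 y hy)))
      (Submodule.smul_mem _ _ (hJ _ _ (hJ _ _ (h2 y hy))))
  · have h3 : g x - g (g x) = e (e ((3 : W) • x + (4 : W) • e x)) := by
      have he' : ∀ x, e x = f x - f (f x) := fun _ => rfl
      simp only [hg, he', map_add, map_sub, map_smul]
      module
    rw [h3]
    exact hee _

section Lift

variable {N : Type u} [AddCommGroup N] [Module W N] (F' : D.P →ₛₗ[σ] N) (Fdot' : D.Q →ₛₗ[σ] N)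

/-- On a multiple of an element of J, Ḟ' is a multiple of a value of F'. So control of F' on K gives
control of Ḟ' on JK. -/
theorem Fdot_mem_of_mem_smul (hF : ∀ (a : RingHom.ker π) (x : D.P),
      Fdot' ⟨(a : W) • x, D.smul_mem a a.2 x⟩ = σd a • F' x) {K : Submodule W D.P}
    {L : Submodule W N} (hKL : ∀ x ∈ K, F' x ∈ L) {x : D.P} (hx : x ∈ RingHom.ker π • K) :
    ∀ hx' : x ∈ D.Q, Fdot' ⟨x, hx'⟩ ∈ L := by
  have key : ∃ hx' : x ∈ D.Q, Fdot' ⟨x, hx'⟩ ∈ L := by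
    refine Submodule.smul_induction_on
      (p := fun x => ∃ hx' : x ∈ D.Q, Fdot' ⟨x, hx'⟩ ∈ L) hx ?_ ?_
    · intro a ha y hy
      exact ⟨D.smul_mem a ha y, by rw [hF ⟨a, ha⟩ y]; exact L.smul_mem _ (hKL y hy)⟩
    · rintro y z ⟨hy, hy'⟩ ⟨hz, hz'⟩
      refine ⟨D.Q.add_mem hy hz, ?_⟩
      have : (⟨y + z, D.Q.add_mem hy hz⟩ : D.Q) = ⟨y, hy⟩ + ⟨z, hz⟩ := rfl
      rw [this, map_add]
      exact L.add_mem hy' hz'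
  exact fun _ => key.2

/-- The linearization of `F' + Fdot'` for an approximate normal decomposition is surjective. -/
theorem exists_surjective_twist {p : ℕ} {v : RingHom.ker π} (hv : σd v = 1) (hσv : σ v = p)
    (hpJ : (p : W) ∈ Ideal.jacobson (⊥ : Ideal W)) (hπ : Function.Surjective π)
    (hF : ∀ (a : RingHom.ker π) (x : D.P),
      Fdot' ⟨(a : W) • x, D.smul_mem a a.2 x⟩ = σd a • F' x)
    (hspan : Submodule.span W (Set.range Fdot') = ⊤) :
    ∃ C : Twist σ D.P →ₗ[W] N, Function.Surjective C := by
  obtain ⟨f, h1, h2, h3⟩ := D.exists_projection hπ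
  have hFQ : ∀ y : D.Q, F' y = (p : W) • Fdot' y := by
    intro y
    have h1 := hF v y
    rw [hv, one_smul] at h1
    rw [← h1, ← hσv, ← LinearMap.map_smulₛₗ]
    rfl
  let r : D.P →ₗ[W] D.Q := LinearMap.codRestrict D.Q (LinearMap.id - f) h1
  have hr : ∀ x, ((r x : D.Q) : D.P) = x - f x := fun _ => rfl
  let A : Twist σ D.P →ₗ[W] N := Twist.lift F'
  let B : Twist σ D.P →ₗ[W] N := Twist.lift (Fdot'.comp r)
  let C : Twist σ D.P →ₗ[W] N := Twist.lift (Fdot'.comp r + F'.comp f)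
  have hdec : ∀ y : D.Q, ∃ h : f y ∈ D.Q, Fdot' y = Fdot' (r y) + Fdot' ⟨f y, h⟩ := by
    intro y
    have h : f y ∈ D.Q := by simpa using D.Q.sub_mem y.2 (h1 y)
    refine ⟨h, ?_⟩
    rw [← map_add]
    congr 1
    exact Subtype.ext (by simp [hr])
  have := D.finite
  have hfin : Module.Finite W N := by
    rw [Module.finite_def]
    -- Finiteness of `N` is needed for Nakayama. The maps F' and Ḟ' ∘ (1 - f) together generate `N`,
    -- since `f` maps Q into JP.
    have h4 : LinearMap.range A ⊔ LinearMap.range B = ⊤ := by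
      rw [eq_top_iff, ← hspan, Submodule.span_le]
      rintro _ ⟨y, rfl⟩
      obtain ⟨h, hy⟩ := hdec y
      rw [hy]
      refine Submodule.add_mem _ (Submodule.mem_sup_right ⟨Twist.tmul σ 1 y, ?_⟩)
        (Submodule.mem_sup_left ?_)
      · exact (Twist.lift_tmul _ _ _).trans (one_smul _ _)
      · refine D.Fdot_mem_of_mem_smul F' Fdot' hF (K := ⊤) (fun x _ => ?_) (h2 y y.2) h
        exact ⟨Twist.tmul σ 1 x, (Twist.lift_tmul _ _ _).trans (one_smul _ _)⟩
    rw [← h4]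
    exact (Module.Finite.iff_fg.1 (Module.Finite.range A)).sup
      (Module.Finite.iff_fg.1 (Module.Finite.range B))
  refine ⟨C, LinearMap.range_eq_top.1 ?_⟩
  have hC : ∀ x, Fdot' (r x) + F' (f x) ∈ LinearMap.range C := fun x =>
    ⟨Twist.tmul σ 1 x, (Twist.lift_tmul _ _ _).trans (one_smul _ _)⟩
  -- By Nakayama it suffices that `C` is surjective modulo p. There F' vanishes on Q, because F' =
  -- pḞ' on Q.
  set L := LinearMap.range C ⊔ Ideal.span {(p : W)} • (⊤ : Submodule W N) with hL
  have hpL : ∀ z : N, (p : W) • z ∈ L := fun z =>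
    Submodule.mem_sup_right (Submodule.smul_mem_smul (Ideal.mem_span_singleton_self _) trivial)
  have hFQL : ∀ y ∈ D.Q, F' y ∈ L := fun y hy => by rw [hFQ ⟨y, hy⟩]; exact hpL _
  have hCL : ∀ x, Fdot' (r x) + F' (f x) ∈ L := fun x => Submodule.mem_sup_left (hC x)
  have hJQ : ∀ x ∈ RingHom.ker π • (⊤ : Submodule W D.P), x ∈ D.Q :=
    fun x hx => (Submodule.smul_le.2 fun a ha x _ => D.smul_mem a ha x :
      RingHom.ker π • (⊤ : Submodule W D.P) ≤ D.Q) hx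
  have hFL : ∀ x, F' x ∈ L := by
    intro x
    -- Idempotence modulo J² enters here: f x - f(f x) lies in J·JP with JP ⊆ Q, so Ḟ' takes it to
    -- combinations of values of F' on Q.
    have h5 : Fdot' (r (f x)) ∈ L :=
      D.Fdot_mem_of_mem_smul F' Fdot' hF (fun z hz => hFQL z (hJQ z hz)) (h3 x) (r (f x)).2
    have h6 : F' (f (f x)) ∈ L := by simpa using L.sub_mem (hCL (f x)) h5
    have h7 : F' (x - f x) ∈ L := hFQL _ (h1 x)
    have h8 : F' (f x - f (f x)) ∈ L := hFQL _ (h1 (f x))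
    have h9 := L.add_mem (L.add_mem h7 h8) h6
    rw [← map_add, ← map_add] at h9
    simpa using h9
  have hLtop : L = ⊤ := by
    rw [eq_top_iff, ← hspan, Submodule.span_le]
    rintro _ ⟨y, rfl⟩
    obtain ⟨h, hy⟩ := hdec y
    rw [hy]
    refine L.add_mem ?_ (D.Fdot_mem_of_mem_smul F' Fdot' hF (K := ⊤) (fun x _ => hFL x)
      (h2 y y.2) h)
    simpa using L.sub_mem (hCL y) (hFL (f y))
  rw [eq_top_iff]
  refine Submodule.le_of_le_smul_of_le_jacobson_bot (I := Ideal.span {(p : W)})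
    (Module.finite_def.1 hfin) ?_ (le_of_eq hLtop.symm)
  rwa [Ideal.span_singleton_le_iff_mem]

/-- The universal property of a display: `σ`-linear maps on `P` and `Q` with the relation between
`F` and `Fdot` extend to a linear map along `Fdot`. -/
theorem exists_lift {p : ℕ} (hp : p ≠ 0) {v : RingHom.ker π} (hv : σd v = 1) (hσv : σ v = p)
    (hpJ : (p : W) ∈ Ideal.jacobson (⊥ : Ideal W)) (hπ : Function.Surjective π)
    (hσ : ∀ x, σ x - x ^ p ∈ Ideal.jacobson (⊥ : Ideal W))
    (hF : ∀ (a : RingHom.ker π) (x : D.P),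
      Fdot' ⟨(a : W) • x, D.smul_mem a a.2 x⟩ = σd a • F' x) :
    ∃ u : D.P →ₗ[W] N, ∀ y, u (D.Fdot y) = Fdot' y := by
  let G : D.Q →ₛₗ[σ] D.P × N := 
    { toFun := fun y => (D.Fdot y, Fdot' y)
      map_add' := fun y z => by simp
      map_smul' := fun w y => by simp [LinearMap.map_smulₛₗ] }
  -- `M` is generated by the pairs (Ḟ y, Ḟ' y). It will be shown to be the graph of the required
  -- map, that is, to project isomorphically onto P.
  let M : Submodule W (D.P × N) := Submodule.span W (Set.range G)
  let Gdot : D.Q →ₛₗ[σ] M :=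
    { toFun := fun y => ⟨G y, Submodule.subset_span ⟨y, rfl⟩⟩
      map_add' := fun y z => Subtype.ext (map_add G y z)
      map_smul' := fun w y => Subtype.ext (LinearMap.map_smulₛₗ G w y) }
  have hGF : ∀ x, (D.F x, F' x) ∈ M := by
    intro x
    have h1 := D.Fdot_smul v x
    have h2 := hF v x
    rw [hv, one_smul] at h1 h2
    rw [← h1, ← h2]
    exact Submodule.subset_span ⟨_, rfl⟩
  let GF : D.P →ₛₗ[σ] M :=
    { toFun := fun x => ⟨_, hGF x⟩
      map_add' := fun y z => Subtype.ext (by simp)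
      map_smul' := fun w y => Subtype.ext (by simp [LinearMap.map_smulₛₗ]) }
  have hGdot : ∀ y, ((Gdot y : M) : D.P × N) = (D.Fdot y, Fdot' y) := fun _ => rfl
  obtain ⟨C, hC⟩ := D.exists_surjective_twist GF Gdot hv hσv hpJ hπ
    (fun a x => Subtype.ext (Prod.ext (D.Fdot_smul a x) (hF a x)))
    (by
      rw [eq_top_iff]
      rintro ⟨z, hz⟩ -
      induction hz using Submodule.span_induction with
      | mem z hz =>
        obtain ⟨y, rfl⟩ := hz
        exact Submodule.subset_span ⟨y, rfl⟩
      | zero => exact Submodule.zero_mem _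
      | add y z _ _ hy hz => exact Submodule.add_mem _ hy hz
      | smul a y _ hy => exact Submodule.smul_mem _ a hy)
  let A : M →ₗ[W] D.P := (LinearMap.fst W D.P N).comp M.subtype
  have hA : Function.Surjective A := by
    rw [← LinearMap.range_eq_top, eq_top_iff, ← D.span_Fdot, Submodule.span_le]
    rintro _ ⟨y, rfl⟩
    exact ⟨Gdot y, rfl⟩
  have := D.finite
  have := D.projective
  -- The composite of the surjections Twist σ P → M → P is bijective by comparison of ranks, hence M
  -- → P is injective.
  have hAC : Function.Bijective (A.comp C) :=
    Twist.bijective_of_surjective σ hp hσ (by rw [LinearMap.coe_comp]; exact hA.comp hC)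
  have hAinj : Function.Injective A := by
    intro y z h
    obtain ⟨y, rfl⟩ := hC y
    obtain ⟨z, rfl⟩ := hC z
    rw [hAC.1 h]
  let e : M ≃ₗ[W] D.P := LinearEquiv.ofBijective A ⟨hAinj, hA⟩
  refine ⟨((LinearMap.snd W D.P N).comp M.subtype).comp e.symm.toLinearMap, fun y => ?_⟩
  have h1 : e.symm (D.Fdot y) = Gdot y := by
    rw [LinearEquiv.symm_apply_eq]
    rfl
  simp only [LinearMap.comp_apply, LinearEquiv.coe_coe, h1]
  rfl

theorem ext_of_Fdot {u u' : D.P →ₗ[W] N} (h : ∀ y, u (D.Fdot y) = u' (D.Fdot y)) : u = u' := by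
  refine LinearMap.ext_on_range (v := D.Fdot) D.span_Fdot h

end Lift

end FrameDisplay

/-! ### Iterated transforms of linear maps and nilpotence -/

namespace FrameDisplay

/-- The conditions under which linear maps out of a display are determined by their composition
with `Fdot`. -/
structure FrobeniusFrame {W R : Type u} [CommRing W] [CommRing R] {π : W →+* R} (p : ℕ)
    (σ : W →+* W) (σd : RingHom.ker π → W) : Prop where
  ne_zero : p ≠ 0
  surj : Function.Surjective π
  exists_one : ∃ v : RingHom.ker π, σd v = 1 ∧ σ v = p
  mem_jacobson : (p : W) ∈ Ideal.jacobson (⊥ : Ideal W)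
  sub_pow_mem : ∀ x, σ x - x ^ p ∈ Ideal.jacobson (⊥ : Ideal W)

section Frame

variable {W R : Type u} [CommRing W] [CommRing R] {π : W →+* R} {σ : W →+* W}
  {σd : RingHom.ker π → W} {p : ℕ}

theorem FrobeniusFrame.lift (hW : FrobeniusFrame p σ σd) (D : FrameDisplay π σ σd) {N : Type u}
    [AddCommGroup N] [Module W N] (F' : D.P →ₛₗ[σ] N) (Fdot' : D.Q →ₛₗ[σ] N)
    (hF : ∀ (a : RingHom.ker π) (x : D.P),
      Fdot' ⟨(a : W) • x, D.smul_mem a a.2 x⟩ = σd a • F' x) :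
    ∃ u : D.P →ₗ[W] N, ∀ y, u (D.Fdot y) = Fdot' y := by
  obtain ⟨v, hv, hσv⟩ := hW.exists_one
  exact D.exists_lift F' Fdot' hW.ne_zero hv hσv hW.mem_jacobson hW.surj hW.sub_pow_mem hF

theorem FrobeniusFrame.F_smul (hW : FrobeniusFrame p σ σd) (D : FrameDisplay π σ σd)
    (a : RingHom.ker π) (x : D.P) : D.F ((a : W) • x) = (p : W) • σd a • D.F x := by
  obtain ⟨v, hv, hσv⟩ := hW.exists_one
  rw [← D.Fdot_smul]
  exact D.map_F_of_mem hv hσv ⟨_, D.smul_mem a a.2 x⟩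

/-- A linear map that is compatible with `Q` and `Fdot` is a homomorphism. -/
def FrobeniusFrame.hom (hW : FrobeniusFrame p σ σd) {D₁ D₂ : FrameDisplay π σ σd}
    (f : D₁.P →ₗ[W] D₂.P) (hQ : ∀ x ∈ D₁.Q, f x ∈ D₂.Q)
    (hf : ∀ x : D₁.Q, f (D₁.Fdot x) = D₂.Fdot ⟨f x, hQ x x.2⟩) : Hom D₁ D₂ where
  toLin := f
  map_Q := hQ
  map_Fdot := hf
  map_F := by
    intro x
    obtain ⟨v, hv, -⟩ := hW.exists_one
    have h1 := D₁.Fdot_smul v x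
    have h2 := D₂.Fdot_smul v (f x)
    rw [hv, one_smul] at h1 h2
    rw [← h1, hf, ← h2]
    congr 1
    exact Subtype.ext (map_smul f _ _)

/-- Sequences of linear maps `b i` with `b (i + 1) (Ḟ y) = φ (b i y)`. -/
def IsFdotSequence (D : FrameDisplay π σ σd) {X : Type u} [AddCommGroup X] [Module W X]
    (φ : X →ₛₗ[σ] X) (b : ℕ → D.P →ₗ[W] X) : Prop :=
  ∀ i (y : D.Q), b (i + 1) (D.Fdot y) = φ (b i y)

/-- By induction, the linearization of φ ∘ e composed with the twisted iterate of `V` agrees with b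
(N + 1) on the values of Ḟ, and these generate P. -/
theorem IsFdotSequence.factor {D : FrameDisplay π σ σd} {X : Type u} [AddCommGroup X] [Module W X]
    {φ : X →ₛₗ[σ] X} {b : ℕ → D.P →ₗ[W] X} (hb : D.IsFdotSequence φ b)
    {V : D.P →ₗ[W] Twist σ D.P} (hV : ∀ y : D.Q, V (D.Fdot y) = Twist.tmul σ 1 (y : D.P)) (N : ℕ) :
    ∃ e : iterTwist σ D.P N →ₗ[W] X, b N = e.comp (iterSharp σ V N) := by
  induction N with
  | zero => exact ⟨b 0, rfl⟩
  | succ N ih =>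
    obtain ⟨e, he⟩ := ih
    refine ⟨Twist.lift (φ.comp e), D.ext_of_Fdot fun y => ?_⟩
    rw [hb, he]
    change φ (e _) = Twist.lift (φ.comp e) (Twist.map σ (iterSharp σ V N) (V (D.Fdot y)))
    rw [hV, Twist.map_tmul, Twist.lift_tmul, one_smul]
    rfl

/-- `N` steps lead into K • X, and one more step applies σ to coefficients in `K`, which makes them
divisible by p. The assumption `hD` concerns all target modules so that the argument can be
repeated. -/
theorem IsFdotSequence.mem_pow_smul {D : FrameDisplay π σ σd} {K : Ideal W} {N : ℕ}
    (hσK : ∀ a ∈ K, σ a ∈ Ideal.span {(p : W)})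
    (hD : ∀ (X : Type u) [AddCommGroup X] [Module W X] (φ : X →ₛₗ[σ] X) (b : ℕ → D.P →ₗ[W] X),
      D.IsFdotSequence φ b → ∀ x, b N x ∈ K • (⊤ : Submodule W X)) (j : ℕ)
    {X : Type u} [AddCommGroup X] [Module W X] {φ : X →ₛₗ[σ] X} {b : ℕ → D.P →ₗ[W] X}
    (hb : D.IsFdotSequence φ b) (x : D.P) : ∃ z : X, b (j * (N + 1)) x = (p : W) ^ j • z := by
  induction j generalizing X with
  | zero => exact ⟨b 0 x, by simp⟩
  | succ j ih =>
    -- Division by p need not be unique in `X`. So the induction replaces `X` by its submodule pX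
    -- and shifts the sequence by N + 1.
    let pX : Submodule W X := Ideal.span {(p : W)} • (⊤ : Submodule W X)
    have hpX : ∀ {z}, z ∈ pX → ∃ z', (p : W) • z' = z := by
      intro z hz
      change z ∈ Ideal.span {(p : W)} • (⊤ : Submodule W X) at hz
      rw [Submodule.ideal_span_singleton_smul, Submodule.mem_smul_pointwise_iff_exists] at hz
      obtain ⟨z', -, hz'⟩ := hz
      exact ⟨z', hz'⟩
    have hφ : ∀ z ∈ pX, φ z ∈ pX := by
      intro z hz
      obtain ⟨z, rfl⟩ := hpX hz
      rw [LinearMap.map_smulₛₗ, map_natCast]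
      exact Submodule.smul_mem_smul (Ideal.mem_span_singleton_self _) trivial
    have hbp : ∀ i x, b (i + (N + 1)) x ∈ pX := by
      intro i
      induction i with
      | zero =>
        intro x
        rw [Nat.zero_add]
        have hx : x ∈ Submodule.span W (Set.range D.Fdot) := by rw [D.span_Fdot]; trivial
        refine (Submodule.span_le (p := pX.comap (b (N + 1)))).2 ?_ hx
        rintro _ ⟨y, rfl⟩
        change b (N + 1) _ ∈ pX
        rw [hb]
        refine Submodule.smul_induction_on (p := fun z => φ z ∈ pX) (hD X φ b hb y) ?_ ?_
        · intro a ha z _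
          rw [LinearMap.map_smulₛₗ]
          exact Submodule.smul_mem_smul (hσK a ha) trivial
        · intro y z hy hz
          rw [map_add]
          exact pX.add_mem hy hz
      | succ i ih =>
        intro x
        have hx : x ∈ Submodule.span W (Set.range D.Fdot) := by rw [D.span_Fdot]; trivial
        refine (Submodule.span_le (p := pX.comap (b (i + 1 + (N + 1))))).2 ?_ hx
        rintro _ ⟨y, rfl⟩
        change b (i + 1 + (N + 1)) _ ∈ pX
        rw [Nat.add_right_comm, hb]
        exact hφ _ (ih _)
    let φ' : pX →ₛₗ[σ] pX :=
      { toFun := fun z => ⟨φ z, hφ z z.2⟩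
        map_add' := fun y z => Subtype.ext (map_add φ _ _)
        map_smul' := fun w z => Subtype.ext (LinearMap.map_smulₛₗ φ _ _) }
    let b' : ℕ → D.P →ₗ[W] pX := fun i => LinearMap.codRestrict pX (b (i + (N + 1))) (hbp i)
    have hb' : D.IsFdotSequence φ' b' := by
      intro i y
      refine Subtype.ext ?_
      change b (i + 1 + (N + 1)) _ = φ (b (i + (N + 1)) _)
      rw [Nat.add_right_comm, hb]
    obtain ⟨⟨z, hz⟩, hz'⟩ := ih hb'
    obtain ⟨z, rfl⟩ := hpX hz
    refine ⟨z, ?_⟩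
    have := congrArg Subtype.val hz'
    change b (j * (N + 1) + (N + 1)) x = (p : W) ^ j • (p : W) • z at this
    rw [Nat.succ_mul, this, smul_smul, pow_succ]

end Frame

/-! ### Lifting homomorphisms along a base change -/

section BaseChange

variable {A B R : Type u} [CommRing A] [CommRing B] [CommRing R] [Algebra A B]
  {πA : A →+* R} {σA : A →+* A} {σdA : RingHom.ker πA → A}
  {πB : B →+* R} {σB : B →+* B} {σdB : RingHom.ker πB → B}
  (h : BaseChangeData σdA σdB σA σB)

/-- Transfers nilpotence from the base change. Modulo `L` the target becomes a `B`-module and the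
sequence descends to the base change. Its N-th term factors through the N-th iterate of `V`, which
has values in the multiples of `K`, and `K` kills the quotient. -/
theorem IsFdotSequence.mem_smul_of_baseChange {D : FrameDisplay πA σA σdA} {K : Ideal B}
    (hK : ∀ a ∈ K, σB a ∈ K) {V : (D.baseChange h).P →ₗ[B] Twist σB (D.baseChange h).P}
    (hV : ∀ y : (D.baseChange h).Q, V ((D.baseChange h).Fdot y) =
      Twist.tmul σB 1 (y : (D.baseChange h).P)) {N : ℕ}
    (hN : ∀ x, iterSharp σB V N x ∈ K • (⊤ : Submodule B (iterTwist σB (D.baseChange h).P N)))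
    {X : Type u} [AddCommGroup X] [Module A X] {φ : X →ₛₗ[σA] X} {b : ℕ → D.P →ₗ[A] X}
    (hb : D.IsFdotSequence φ b) (x : D.P) :
    b N x ∈ K.comap (algebraMap A B) • (⊤ : Submodule A X) := by
  set L := K.comap (algebraMap A B) • (⊤ : Submodule A X) with hL
  have hsm : ∀ a, algebraMap A B a ∈ K → ∀ x : X ⧸ L, a • x = 0 := by
    intro a ha x
    obtain ⟨x, rfl⟩ := Submodule.Quotient.mk_surjective _ x
    rw [← Submodule.Quotient.mk_smul, Submodule.Quotient.mk_eq_zero]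
    exact Submodule.smul_mem_smul ha trivial
  obtain ⟨m, hm⟩ := exists_module_of_surjective h.surj (M := X ⧸ L) (by
    intro a ha x
    exact hsm a (by rw [RingHom.mem_ker.1 ha]; exact K.zero_mem) x)
  have : IsScalarTower A B (X ⧸ L) := by
    refine ⟨fun a b x => ?_⟩
    rw [Algebra.smul_def, mul_smul, hm]
  have hφL : ∀ z ∈ L, φ z ∈ L := by
    intro z hz
    refine Submodule.smul_induction_on (p := fun z => φ z ∈ L) hz ?_ ?_
    · intro a ha z _
      rw [LinearMap.map_smulₛₗ]
      refine Submodule.smul_mem_smul ?_ trivial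
      rw [Ideal.mem_comap, ← h.comm_σ]
      exact hK _ ha
    · intro y z hy hz
      rw [map_add]
      exact L.add_mem hy hz
  let φL : (X ⧸ L) →ₛₗ[σA] (X ⧸ L) := Submodule.mapQ L L φ hφL
  let φB : (X ⧸ L) →ₛₗ[σB] (X ⧸ L) :=
    { φL with
      map_smul' := by
        intro c z
        obtain ⟨a, rfl⟩ := h.surj c
        change φL (algebraMap A B a • z) = σB (algebraMap A B a) • φL z
        rw [hm, LinearMap.map_smulₛₗ, h.comm_σ, hm] }
  let bB : ℕ → (D.baseChange h).P →ₗ[B] (X ⧸ L) := fun i =>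
    show B ⊗[A] D.P →ₗ[B] (X ⧸ L) from LinearMap.liftBaseChange B (L.mkQ.comp (b i))
  have hbB : ∀ i x, bB i ((1 : B) ⊗ₜ[A] x) = L.mkQ (b i x) := by
    intro i x
    exact (LinearMap.liftBaseChange_tmul B _ _ _).trans (one_smul B _)
  have hseq : (D.baseChange h).IsFdotSequence φB bB := by
    rintro i ⟨_, q, hq, rfl⟩
    have e : (D.baseChange h).Fdot ⟨(1 : B) ⊗ₜ[A] q, ⟨q, hq, rfl⟩⟩ = (1 : B) ⊗ₜ[A] D.Fdot ⟨q, hq⟩ :=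
      baseChangeFdot_one_tmul D h ⟨q, hq⟩ _
    refine (congrArg (bB (i + 1)) e).trans ?_
    rw [hbB, hb]
    exact (congrArg φB (hbB i q)).symm
  obtain ⟨e, he⟩ := hseq.factor hV N
  have h1 : bB N ((1 : B) ⊗ₜ[A] x) = 0 := by
    rw [he]
    refine Submodule.smul_induction_on (p := fun z => e z = 0) (hN ((1 : B) ⊗ₜ[A] x)) ?_ ?_
    · intro c hc z _
      obtain ⟨a, rfl⟩ := h.surj c
      rw [map_smul, hm]
      exact hsm a hc _
    · intro y z hy hz
      rw [map_add, hy, hz, add_zero]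
  rw [hbB] at h1
  exact (Submodule.Quotient.mk_eq_zero _).1 h1

/-- The kernel of `P → B ⊗ P`. -/
def baseChangeKer (B : Type u) [CommRing B] [Algebra A B] (D : FrameDisplay πA σA σdA) :
    Submodule A D.P :=
  LinearMap.ker (TensorProduct.mk A B D.P 1)

variable {D D₁ D₂ : FrameDisplay πA σA σdA}

theorem mem_baseChangeKer {x : D.P} : x ∈ D.baseChangeKer B ↔ (1 : B) ⊗ₜ[A] x = 0 := Iff.rfl

theorem mem_baseChangeKer_iff (h : BaseChangeData σdA σdB σA σB) {x : D.P} :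
    x ∈ D.baseChangeKer B ↔ x ∈ RingHom.ker (algebraMap A B) • (⊤ : Submodule A D.P) := by
  refine ⟨fun hx => one_tmul_eq_zero h.surj hx, fun hx => ?_⟩
  refine (Submodule.smul_le (P := D.baseChangeKer B)).2 (fun a ha x _ => ?_) hx
  rw [mem_baseChangeKer, ← smul_one_tmul, RingHom.mem_ker.1 ha, zero_smul]

theorem baseChangeKer_le (h : BaseChangeData σdA σdB σA σB) : D.baseChangeKer B ≤ D.Q := by
  intro x hx
  exact (Submodule.smul_le (P := D.Q)).2 (fun a ha x _ => D.smul_mem a (ker_le h ha) x)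
    ((mem_baseChangeKer_iff h).1 hx)

/-- The operator `Fdot` on the kernel of `P → B ⊗ P`. -/
noncomputable def kerFdot (h : BaseChangeData σdA σdB σA σB) (D : FrameDisplay πA σA σdA) :
    D.baseChangeKer B →ₛₗ[σA] D.baseChangeKer B where
  toFun z := ⟨D.Fdot ⟨z, baseChangeKer_le h z.2⟩, one_tmul_Fdot_eq_zero D h z.2⟩
  map_add' y z := Subtype.ext (map_add D.Fdot ⟨y, baseChangeKer_le h y.2⟩ ⟨z, _⟩)
  map_smul' a z := Subtype.ext (LinearMap.map_smulₛₗ D.Fdot a ⟨z, baseChangeKer_le h z.2⟩)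

/-- The operator `F` on the kernel of `P → B ⊗ P`. -/
noncomputable def kerF (h : BaseChangeData σdA σdB σA σB) (D : FrameDisplay πA σA σdA) :
    D.baseChangeKer B →ₛₗ[σA] D.baseChangeKer B where
  toFun z := ⟨D.F z, one_tmul_F_eq_zero D h z.2⟩
  map_add' y z := Subtype.ext (map_add D.F (y : D.P) z)
  map_smul' a z := Subtype.ext (LinearMap.map_smulₛₗ D.F a (z : D.P))

theorem kerFdot_coe (z : D.baseChangeKer B) :
    (kerFdot h D z : D.P) = D.Fdot ⟨z, baseChangeKer_le h z.2⟩ := rfl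

theorem baseChange_toLin_one_tmul (α : Hom D₁ D₂) (x : D₁.P) :
    (α.baseChange h).toLin ((1 : B) ⊗ₜ[A] x) = (1 : B) ⊗ₜ[A] α.toLin x :=
  LinearMap.baseChange_tmul _ _ _

theorem baseChange_hom_ext {α β : Hom (D₁.baseChange h) (D₂.baseChange h)}
    (e : ∀ x : D₁.P, α.toLin ((1 : B) ⊗ₜ[A] x) = β.toLin ((1 : B) ⊗ₜ[A] x)) : α = β := by
  refine Hom.ext (LinearMap.ext fun z => ?_)
  obtain ⟨x, rfl⟩ := one_tmul_surjective (B := B) h.surj D₁.P z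
  exact e x

/-- The next term of a sequence of maps into the kernel of the reduction. -/
theorem FrobeniusFrame.exists_next {p : ℕ} (hA : FrobeniusFrame p σA σdA)
    (β : D₁.P →ₗ[A] D₂.baseChangeKer B) :
    ∃ β' : D₁.P →ₗ[A] D₂.baseChangeKer B, ∀ y : D₁.Q, β' (D₁.Fdot y) = kerFdot h D₂ (β y) := by
  obtain ⟨u, hu⟩ := hA.lift D₁ ((kerF h D₂).comp β) ((kerFdot h D₂).comp (β.comp D₁.Q.subtype))
    (by
      intro a x
      refine Subtype.ext ?_
      refine Eq.trans ?_ (D₂.Fdot_smul a (β x))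
      change D₂.Fdot _ = _
      congr 1
      refine Subtype.ext ?_
      change ((β ((a : A) • x) : D₂.baseChangeKer B) : D₂.P) = (a : A) • (β x : D₂.P)
      rw [map_smul]
      rfl)
  exact ⟨u, hu⟩

/-- The difference of two lifts has values in the kernel and solves the homogeneous equation. -/
theorem baseChange_injective (hβ : ∀ β : D₁.P →ₗ[A] D₂.baseChangeKer B,
      (∀ y : D₁.Q, β (D₁.Fdot y) = kerFdot h D₂ (β y)) → β = 0) :
    Function.Injective (Hom.baseChange h : Hom D₁ D₂ → _) := by
  intro α α' e
  have hmem : ∀ x, (α.toLin - α'.toLin) x ∈ D₂.baseChangeKer B := by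
    intro x
    rw [mem_baseChangeKer, LinearMap.sub_apply, TensorProduct.tmul_sub, sub_eq_zero,
      ← LinearMap.baseChange_tmul, ← LinearMap.baseChange_tmul]
    exact congrArg (fun γ => γ.toLin ((1 : B) ⊗ₜ[A] x)) e
  have h0 := hβ (LinearMap.codRestrict _ _ hmem) (by
    intro y
    refine Subtype.ext ?_
    rw [kerFdot_coe]
    change α.toLin _ - α'.toLin _ = _
    rw [α.map_Fdot, α'.map_Fdot, ← map_sub]
    rfl)
  refine Hom.ext (LinearMap.ext fun x => ?_)
  exact sub_eq_zero.1 (congrArg Subtype.val (LinearMap.congr_fun h0 x))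

theorem baseChange_surjective {p : ℕ} (hA : FrobeniusFrame p σA σdA)
    (hβ : ∀ ε : D₁.P →ₗ[A] D₂.baseChangeKer B, ∃ β : D₁.P →ₗ[A] D₂.baseChangeKer B,
      ∀ y : D₁.Q, β (D₁.Fdot y) = ε (D₁.Fdot y) + kerFdot h D₂ (β y)) :
    Function.Surjective (Hom.baseChange h : Hom D₁ D₂ → _) := by
  intro α
  have := D₁.projective
  obtain ⟨α₀, h₀⟩ := Module.projective_lifting_property (TensorProduct.mk A B D₂.P 1)
    (((show B ⊗[A] D₁.P →ₗ[B] B ⊗[A] D₂.P from α.toLin).restrictScalars A).comp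
      (TensorProduct.mk A B D₁.P 1)) (one_tmul_surjective h.surj D₂.P)
  have h₀' : ∀ x, (1 : B) ⊗ₜ[A] α₀ x = α.toLin ((1 : B) ⊗ₜ[A] x) := LinearMap.congr_fun h₀
  have hQ : ∀ x ∈ D₁.Q, α₀ x ∈ D₂.Q := by
    intro x hx
    obtain ⟨q, hq, e⟩ := α.map_Q ((1 : B) ⊗ₜ[A] x) ⟨x, hx, rfl⟩
    rw [← h₀'] at e
    have h1 : α₀ x - q ∈ D₂.baseChangeKer B := by
      rw [mem_baseChangeKer, TensorProduct.tmul_sub, e, sub_self]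
    simpa using D₂.Q.add_mem (baseChangeKer_le h h1) hq
  -- `u` is what `α₀` would have to be on the values of Ḟ in order to commute with Ḟ; α₀ - u
  -- measures the failure.
  obtain ⟨u, hu⟩ := hA.lift D₁ (D₂.F.comp α₀) (D₂.Fdot.comp (α₀.restrict hQ)) (by
    intro a x
    refine Eq.trans ?_ (D₂.Fdot_smul a (α₀ x))
    change D₂.Fdot _ = _
    congr 1
    exact Subtype.ext (map_smul α₀ (a : A) x))
  have hu' : ∀ y : D₁.Q, u (D₁.Fdot y) = D₂.Fdot ⟨α₀ y, hQ y y.2⟩ := hu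
  -- After base change both `α₀` and `u` agree with `α` on values of Ḟ, since `α` commutes with Ḟ.
  have hεmem : ∀ x, (α₀ - u) x ∈ D₂.baseChangeKer B := by
    intro x
    have hx : x ∈ Submodule.span A (Set.range D₁.Fdot) := by rw [D₁.span_Fdot]; trivial
    refine (Submodule.span_le (p := (D₂.baseChangeKer B).comap (α₀ - u))).2 ?_ hx
    rintro _ ⟨y, rfl⟩
    change (1 : B) ⊗ₜ[A] (α₀ (D₁.Fdot y) - u (D₁.Fdot y)) = 0
    rw [TensorProduct.tmul_sub, h₀', hu']
    refine sub_eq_zero.2 ?_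
    have e1 := baseChangeFdot_one_tmul D₁ h y ⟨y, y.2, rfl⟩
    have e2 := baseChangeFdot_one_tmul D₂ h ⟨α₀ y, hQ y y.2⟩ ⟨α₀ y, hQ y y.2, rfl⟩
    have e3 := α.map_Fdot ⟨(1 : B) ⊗ₜ[A] (y : D₁.P), ⟨y, y.2, rfl⟩⟩
    refine (congrArg α.toLin e1).symm.trans (e3.trans (Eq.trans ?_ e2))
    exact baseChangeFdot_congr D₂ h (h₀' y).symm _ _
  obtain ⟨β, hβ⟩ := hβ (LinearMap.codRestrict _ _ hεmem)
  have hβ' : ∀ y : D₁.Q, (β (D₁.Fdot y) : D₂.P) = α₀ (D₁.Fdot y) - D₂.Fdot ⟨α₀ y, hQ y y.2⟩ +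
      D₂.Fdot ⟨β y, baseChangeKer_le h (β y).2⟩ := by
    intro y
    rw [hβ, ← hu']
    rfl
  refine ⟨hA.hom (α₀ - (D₂.baseChangeKer B).subtype.comp β)
    (fun x hx => D₂.Q.sub_mem (hQ x hx) (baseChangeKer_le h (β x).2)) (fun y => ?_), ?_⟩
  · change α₀ (D₁.Fdot y) - (β (D₁.Fdot y) : D₂.P) = _
    rw [hβ', sub_add_eq_sub_sub, sub_sub_cancel, ← map_sub]
    rfl
  · refine baseChange_hom_ext h fun x => ?_
    rw [baseChange_toLin_one_tmul, ← h₀']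
    change (1 : B) ⊗ₜ[A] (α₀ x - (β x : D₂.P)) = _
    rw [TensorProduct.tmul_sub, mem_baseChangeKer.1 (β x).2, sub_zero]

/-- If all sequences of maps into the kernel of the reduction end in zero, then homomorphisms lift
uniquely. -/
theorem baseChange_bijective {p : ℕ} (hA : FrobeniusFrame p σA σdA) {m : ℕ}
    (hm : ∀ b : ℕ → D₁.P →ₗ[A] D₂.baseChangeKer B, D₁.IsFdotSequence (kerFdot h D₂) b → b m = 0) :
    Function.Bijective (Hom.baseChange h : Hom D₁ D₂ → _) := by
  -- A solution of the homogeneous equation is a constant sequence, hence zero.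
  refine ⟨baseChange_injective h fun β hβ => hm (fun _ => β) fun _ => hβ,
    baseChange_surjective h hA fun ε => ?_⟩
  choose g hg using fun β : D₁.P →ₗ[A] D₂.baseChangeKer B => hA.exists_next h β
  let b : ℕ → D₁.P →ₗ[A] D₂.baseChangeKer B := fun n => g^[n] ε
  have hb : D₁.IsFdotSequence (kerFdot h D₂) b := by
    intro i y
    change (g^[i + 1] ε) _ = _
    rw [Function.iterate_succ_apply', hg]
  -- The geometric series ε + Uε + ⋯ + U^(m-1)ε; it solves the equation because the term with index
  -- `m` vanishes.
  refine ⟨∑ i ∈ Finset.range m, b i, fun y => ?_⟩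
  have h1 : ∑ i ∈ Finset.range m, b i = b 0 + ∑ i ∈ Finset.range m, b (i + 1) := by
    rw [add_comm, ← Finset.sum_range_succ', Finset.sum_range_succ, hm b hb, add_zero]
  conv_lhs => rw [h1]
  rw [LinearMap.add_apply, LinearMap.sum_apply, LinearMap.sum_apply, map_sum]
  congr 1
  exact Finset.sum_congr rfl fun i _ => hb i y

/-- A dual basis of `M`: `c j z` is the j-th coordinate function times `z`. It makes Hom(M, N)
finite and turns maps with values in KN into `K`-combinations of maps. -/
theorem exists_eq_sum_of_projective (M N : Type u) [AddCommGroup M] [Module A M] [AddCommGroup N]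
    [Module A N] [Module.Finite A M] [Module.Projective A M] :
    ∃ (n : ℕ) (c : Fin n → N →ₗ[A] (M →ₗ[A] N)) (x : Fin n → M),
      ∀ β : M →ₗ[A] N, β = ∑ j, c j (β (x j)) := by
  obtain ⟨n, r, hr⟩ := Module.Finite.exists_fin' A M
  obtain ⟨s, hs⟩ := Module.projective_lifting_property r LinearMap.id hr
  let c : Fin n → N →ₗ[A] (M →ₗ[A] N) := fun j =>
    LinearMap.smulRightₗ ((LinearMap.proj j : (Fin n → A) →ₗ[A] A).comp s)
  have hc : ∀ j z x, c j z x = s x j • z := fun _ _ _ => rfl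
  refine ⟨n, c, fun j => r (Pi.single j 1), fun β => ?_⟩
  ext x
  rw [LinearMap.sum_apply]
  conv_lhs => rw [← LinearMap.id_apply (R := A) x, ← hs, LinearMap.comp_apply,
    ← Finset.univ_sum_single (s x), map_sum, map_sum]
  refine Finset.sum_congr rfl fun j _ => ?_
  rw [hc, ← map_smul, ← map_smul, ← Pi.single_smul, smul_eq_mul, mul_one]

theorem finite_hom_of_projective (M N : Type u) [AddCommGroup M] [Module A M] [AddCommGroup N]
    [Module A N] [Module.Finite A M] [Module.Projective A M] [Module.Finite A N] :
    Module.Finite A (M →ₗ[A] N) := by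
  obtain ⟨n, c, x, h⟩ := exists_eq_sum_of_projective (A := A) M N
  refine Module.Finite.of_surjective (∑ j, (c j).comp (LinearMap.proj j : (Fin n → N) →ₗ[A] N))
    fun β => ⟨fun j => β (x j), ?_⟩
  rw [LinearMap.sum_apply]
  exact (h β).symm

theorem mem_smul_top_of_forall_mem {M N : Type u} [AddCommGroup M] [Module A M] [AddCommGroup N]
    [Module A N] [Module.Finite A M] [Module.Projective A M] (K : Ideal A) {β : M →ₗ[A] N}
    (hβ : ∀ x, β x ∈ K • (⊤ : Submodule A N)) : β ∈ K • (⊤ : Submodule A (M →ₗ[A] N)) := by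
  obtain ⟨n, c, x, h⟩ := exists_eq_sum_of_projective (A := A) M N
  rw [h β]
  refine Submodule.sum_mem _ fun j _ => ?_
  have h2 := Submodule.mem_map_of_mem (f := c j) (hβ (x j))
  rw [Submodule.map_smul''] at h2
  exact Submodule.smul_mono le_rfl le_top h2

/-- If certain systems of equations have solutions in the kernel of `A → B`, then homomorphisms
lift. -/
theorem baseChange_surjective_of_solvable {p : ℕ} (hA : FrobeniusFrame p σA σdA)
    (hsolve : ∀ (n : ℕ) (g : Fin n → Fin n → A) (ε : Fin n → A),
      (∀ t, ε t ∈ RingHom.ker (algebraMap A B)) → ∃ c : Fin n → RingHom.ker πA,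
        (∀ t, (c t : A) ∈ RingHom.ker (algebraMap A B)) ∧
        ∀ t, (c t : A) = ε t + ∑ t', σdA (c t') * g t' t) :
    Function.Surjective (Hom.baseChange h : Hom D₁ D₂ → _) := by
  refine baseChange_surjective h hA fun ε => ?_
  have := D₁.finite
  have := D₁.projective
  have := D₂.finite
  have := finite_hom_of_projective (A := A) D₁.P D₂.P
  -- The solution is sought as ∑ c t • f t for generators `f t` of Hom(P₁, P₂), with `c t` in the
  -- kernel of A → B.
  obtain ⟨n, f, hf⟩ := Module.Finite.exists_fin (R := A) (M := D₁.P →ₗ[A] D₂.P)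
  have h1 : (D₂.baseChangeKer B).subtype.comp ε ∈
      RingHom.ker (algebraMap A B) • Submodule.span A (Set.range f) := by
    rw [hf]
    exact mem_smul_top_of_forall_mem _ fun x => (mem_baseChangeKer_iff h).1 (ε x).2
  obtain ⟨e, he, hεe⟩ := (Submodule.mem_ideal_smul_span_iff_exists_sum _ _ _).1 h1
  rw [Finsupp.sum_fintype _ _ (by simp)] at hεe
  -- The universal property applies to F ∘ f t on Q₁ paired with pF ∘ f t on P₁, because F(ax) =
  -- pσ̇(a)F(x) for a in J. The coefficients `g` express `u t` through the generators again.
  have h2 : ∀ t, ∃ u : D₁.P →ₗ[A] D₂.P, ∀ y : D₁.Q, u (D₁.Fdot y) = D₂.F (f t y) := by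
    intro t
    obtain ⟨u, hu⟩ := hA.lift D₁ ((p : A) • (D₂.F.comp (f t)))
      (D₂.F.comp ((f t).comp D₁.Q.subtype)) (by
        intro a x
        change D₂.F (f t ((a : A) • x)) = σdA a • (p : A) • D₂.F (f t x)
        rw [map_smul, hA.F_smul, smul_comm])
    exact ⟨u, hu⟩
  choose u hu using h2
  have h3 : ∀ t, ∃ g : Fin n → A, ∑ i, g i • f i = u t := fun t =>
    (Submodule.mem_span_range_iff_exists_fun A).1 (by rw [hf]; trivial)
  choose g hg using h3
  obtain ⟨c, hc, hc'⟩ := hsolve n g e he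
  have hmem : ∀ x, (∑ t, (c t : A) • f t) x ∈ D₂.baseChangeKer B := by
    intro x
    rw [LinearMap.sum_apply]
    refine Submodule.sum_mem _ fun t _ => ?_
    rw [mem_baseChangeKer, LinearMap.smul_apply, ← smul_one_tmul, RingHom.mem_ker.1 (hc t), zero_smul]
  refine ⟨LinearMap.codRestrict _ _ hmem, fun y => Subtype.ext ?_⟩
  have h4 : ∑ t, (c t : A) • f t = (D₂.baseChangeKer B).subtype.comp ε +
      ∑ t, σdA (c t) • u t := by
    rw [← hεe]
    simp only [← hg, Finset.smul_sum, smul_smul]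
    rw [Finset.sum_comm, ← Finset.sum_add_distrib]
    refine Finset.sum_congr rfl fun t _ => ?_
    rw [hc' t, add_smul, Finset.sum_smul]
  -- Since `c t` lies in J, Ḟ takes c t • f t z to σ̇(c t) • F(f t z).
  have h5 : ∀ z : D₁.Q, ∀ hz : (∑ t, (c t : A) • f t) z ∈ D₂.Q,
      D₂.Fdot ⟨(∑ t, (c t : A) • f t) z, hz⟩ = ∑ t, σdA (c t) • u t (D₁.Fdot z) := by
    intro z hz
    simp only [hu, ← D₂.Fdot_smul, ← map_sum]
    congr 1
    refine Subtype.ext ?_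
    rw [AddSubmonoidClass.coe_finsetSum]
    exact LinearMap.sum_apply _ _ _
  refine Eq.trans ?_ (congrArg ((ε (D₁.Fdot y) : D₂.P) + ·)
    (h5 y (baseChangeKer_le h (hmem y))).symm)
  change (∑ t, (c t : A) • f t) (D₁.Fdot y) = _
  rw [h4, LinearMap.add_apply, LinearMap.sum_apply]
  rfl

end BaseChange
end FrameDisplay

/-! ### Relative displays: the operator σ̇ on W(𝔞) and the two parts of the theorem -/

section Relative

open WittVector FrameDisplay

variable {p : ℕ} [hp : Fact p.Prime] {S R : Type u} [CommRing S] [CommRing R] [Algebra S R]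
  (γ : DividedPowers (RingHom.ker (algebraMap S R)))

theorem mem_ker_map_iff {x : WittVector p S} :
    x ∈ RingHom.ker (WittVector.map (p := p) (algebraMap S R)) ↔
      ∀ n, x.coeff n ∈ RingHom.ker (algebraMap S R) := by
  rw [RingHom.mem_ker, WittVector.map_eq_zero_iff]
  rfl

theorem relSigmaDot_coeff_mem (x : RingHom.ker (wittToResidue p S R))
    (hx : ∀ n, (x : WittVector p S).coeff n ∈ RingHom.ker (algebraMap S R)) (n : ℕ) :
    (relSigmaDot p γ x).coeff n ∈ RingHom.ker (algebraMap S R) := by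
  rw [relSigmaDot, shift_coeff]
  exact coeff_mem_iff.2 (Ideal.sub_mem _ (coeff_mem_iff.1 hx)
    (coeff_mem_iff.1 (logTeich_coeff_mem p γ (hx 0)))) _

/-- Removing the logarithmic Teichmüller part changes only the coordinate with index 0, and V shifts
coordinates up by one. So σ̇ shifts them down. -/
theorem logCoord_relSigmaDot (x : RingHom.ker (wittToResidue p S R))
    (hx : ∀ n, (x : WittVector p S).coeff n ∈ RingHom.ker (algebraMap S R)) (n : ℕ) :
    logCoord p γ (relSigmaDot p γ x) n = logCoord p γ (x : WittVector p S) (n + 1) := by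
  have h1 := relSigmaDot_spec p γ x
  have h2 := logTeich_coeff_mem p γ (hx 0)
  have h3 : ∀ n, (verschiebung (relSigmaDot p γ x)).coeff n ∈ RingHom.ker (algebraMap S R) := by
    have := Ideal.sub_mem _ (coeff_mem_iff.1 hx) (coeff_mem_iff.1 h2)
    rw [sub_eq_of_eq_add' h1] at this
    exact coeff_mem_iff.2 this
  rw [← logCoord_verschiebung]
  conv_rhs => rw [h1]
  rw [logCoord_add p γ h2 h3, logCoord_logTeich p γ (hx 0), if_neg (Nat.succ_ne_zero n), zero_add]

/-- Since Vσ(x) = V(1)x and the positive ghost components of V(1) are p, the n-th coordinate of σ(x)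
is p times the coordinate of x with index n + 1. -/
theorem frobenius_eq_natCast_mul_relSigmaDot (x : RingHom.ker (wittToResidue p S R))
    (hx : ∀ n, (x : WittVector p S).coeff n ∈ RingHom.ker (algebraMap S R)) :
    frobenius (x : WittVector p S) = p * relSigmaDot p γ x := by
  have h1 : ∀ n, (frobenius (x : WittVector p S)).coeff n ∈ RingHom.ker (algebraMap S R) := by
    rw [← mem_ker_map_iff] at hx ⊢
    rw [RingHom.mem_ker, IsPoly.map (frobenius_isPoly p) (algebraMap S R) (x : WittVector p S),
      RingHom.mem_ker.1 hx, map_zero]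
  have h2 := relSigmaDot_coeff_mem γ x hx
  refine eq_of_logCoord_eq p γ h1 (coeff_mem_iff.2 (Ideal.mul_mem_left _ _ (coeff_mem_iff.1 h2)))
    fun n => ?_
  rw [logCoord_mul p γ _ h2, map_natCast, logCoord_relSigmaDot γ x hx, ← logCoord_verschiebung]
  have h3 := verschiebung_mul_frobenius (1 : WittVector p S) (x : WittVector p S)
  rw [one_mul] at h3
  rw [h3, logCoord_mul p γ _ hx, ghostComponent_verschiebung, map_one, mul_one]

theorem frobeniusFrame (hs : Function.Surjective (algebraMap S R)) (hS : IsNilpotent (p : S)) :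
    FrobeniusFrame p (frobenius : WittVector p S →+* _) (relSigmaDot p γ) where
  ne_zero := hp.out.ne_zero
  surj := hs.comp (constantCoeff_surjective p)
  exists_one := by
    have h0 : verschiebung (1 : WittVector p S) ∈ RingHom.ker (wittToResidue p S R) := by
      change algebraMap S R ((verschiebung (1 : WittVector p S)).coeff 0) = 0
      rw [verschiebung_coeff_zero, map_zero]
    -- The element V(1) has logarithmic Teichmüller part zero, so σ̇ inverts V on it.
    refine ⟨⟨_, h0⟩, relSigmaDot_eq p γ _ 0 _ ?_, ?_⟩
    · rw [logTeich_zero, zero_add]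
    · rw [frobenius_verschiebung, one_mul]
  mem_jacobson := natCast_mem_jacobson hS
  sub_pow_mem := frobenius_sub_pow_mem_jacobson hS

theorem frobenius_mem_span_of_map_mem (γ : DividedPowers (RingHom.ker (algebraMap S R)))
    (hs : Function.Surjective (algebraMap S R))
    {x : WittVector p S} (hx : WittVector.map (algebraMap S R) x ∈
      RingHom.ker (constantCoeff : WittVector p R →+* R) ⊔ Ideal.span {(p : WittVector p R)}) :
    frobenius x ∈ Ideal.span {(p : WittVector p S)} := by
  obtain ⟨y, hy, z, hz, hyz⟩ := Submodule.mem_sup.1 hx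
  obtain ⟨z, rfl⟩ := Ideal.mem_span_singleton'.1 hz
  have hy' := verschiebung_verschiebungInv p R ⟨y, hy⟩
  obtain ⟨y', hy''⟩ := WittVector.map_surjective (p := p) _ hs (verschiebungInv p R ⟨y, hy⟩)
  obtain ⟨z, rfl⟩ := WittVector.map_surjective (p := p) _ hs z
  -- Lifting the two summands leaves a remainder in W(𝔞). Frobenius makes each term divisible by p:
  -- σV = p, and σ = pσ̇ on W(𝔞).
  set k := x - verschiebung y' - z * p with hk
  have hk0 : ∀ n, k.coeff n ∈ RingHom.ker (algebraMap S R) := by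
    rw [← mem_ker_map_iff, RingHom.mem_ker, hk, map_sub, map_sub, map_verschiebung, hy'', hy',
      ← hyz, map_mul, map_natCast]
    ring
  have hkJ : k ∈ RingHom.ker (wittToResidue p S R) := hk0 0
  have h1 : x = k + verschiebung y' + z * p := by rw [hk]; ring
  rw [h1, map_add, map_add, frobenius_verschiebung, map_mul, map_natCast,
    frobenius_eq_natCast_mul_relSigmaDot γ ⟨k, hkJ⟩ hk0]
  refine Ideal.add_mem _ (Ideal.add_mem _ ?_ ?_) ?_
  · exact Ideal.mul_mem_right _ _ (Ideal.mem_span_singleton_self _)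
  · exact Ideal.mul_mem_left _ _ (Ideal.mem_span_singleton_self _)
  · exact Ideal.mul_mem_left _ _ (Ideal.mem_span_singleton_self _)

theorem frobenius_mem_of_mem {x : WittVector p R}
    (hx : x ∈ RingHom.ker (constantCoeff : WittVector p R →+* R) ⊔
      Ideal.span {(p : WittVector p R)}) :
    frobenius x ∈ RingHom.ker (constantCoeff : WittVector p R →+* R) ⊔
      Ideal.span {(p : WittVector p R)} := by
  obtain ⟨y, hy, z, hz, rfl⟩ := Submodule.mem_sup.1 hx
  obtain ⟨z, rfl⟩ := Ideal.mem_span_singleton'.1 hz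
  have hy' := verschiebung_verschiebungInv p R ⟨y, hy⟩
  change _ = y at hy'
  rw [← hy', map_add, frobenius_verschiebung, map_mul, map_natCast]
  exact Submodule.mem_sup_right (Ideal.add_mem _
    (Ideal.mul_mem_left _ _ (Ideal.mem_span_singleton_self _))
    (Ideal.mul_mem_left _ _ (Ideal.mem_span_singleton_self _)))

/-- Systems of equations `c t = ε t + ∑ t', σ̇ (c t') * g t' t` in `W(𝔞)` have solutions if `𝔞` is
artinian. -/
theorem exists_eq_add_sum_relSigmaDot [IsArtinian S (RingHom.ker (algebraMap S R))] (n : ℕ)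
    (g : Fin n → Fin n → WittVector p S) (ε : Fin n → WittVector p S)
    (hε : ∀ t, ε t ∈ RingHom.ker (WittVector.map (p := p) (algebraMap S R))) :
    ∃ c : Fin n → RingHom.ker (wittToResidue p S R),
      (∀ t, (c t : WittVector p S) ∈ RingHom.ker (WittVector.map (p := p) (algebraMap S R))) ∧
      ∀ t, (c t : WittVector p S) = ε t + ∑ t', relSigmaDot p γ (c t') * g t' t := by
  let I := RingHom.ker (algebraMap S R)
  have hε' := fun t => mem_ker_map_iff.1 (hε t)
  have hlog : ∀ x : WittVector p S, (∀ n, x.coeff n ∈ I) → ∀ n, logCoord p γ x n ∈ I := by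
    intro x hx n
    exact I.sum_mem fun i _ => I.mul_mem_left _
      (γ.dpow_mem (pow_ne_zero _ hp.out.ne_zero) (hx i))
  -- The system in the logarithmic coordinates of index `k`: the shift σ̇ brings in the unknowns of
  -- index k + 1, and the factors `g` act through their k-th ghost components.
  let u : ℕ → (Fin n → I) →ₗ[S] (Fin n → I) := fun k => LinearMap.pi fun t =>
    ∑ t', ghostComponent k (g t' t) • (LinearMap.proj t' : (Fin n → I) →ₗ[S] I)
  have hu : ∀ k (b : Fin n → I) t, ((u k b t : I) : S) =
      ∑ t', ghostComponent k (g t' t) * (b t' : S) := by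
    intro k b t
    simp [u]
  obtain ⟨β, hβ⟩ := exists_forall_eq_add_of_isArtinian u
    (fun k t => (⟨logCoord p γ (ε t) k, hlog _ (hε' t) k⟩ : I))
  have hβ' : ∀ k t, (β k t : S) = logCoord p γ (ε t) k +
      ∑ t', ghostComponent k (g t' t) * (β (k + 1) t' : S) := by
    intro k t
    rw [← hu]
    exact congrArg (fun b : Fin n → I => ((b t : I) : S)) (hβ k)
  choose c hc hcβ using fun t => exists_logCoord_eq p γ (a := fun k => (β k t : S))
    fun k => (β k t).2
  let c' : Fin n → RingHom.ker (wittToResidue p S R) := fun t => ⟨c t, hc t 0⟩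
  have hc' : ∀ t t' n, (relSigmaDot p γ (c' t') * g t' t).coeff n ∈ I := fun t t' =>
    coeff_mem_iff.2 (Ideal.mul_mem_right _ _
      (coeff_mem_iff.1 (relSigmaDot_coeff_mem γ (c' t') (hc t'))))
  have hsum : ∀ t n, (∑ t', relSigmaDot p γ (c' t') * g t' t).coeff n ∈ I := fun t =>
    coeff_mem_iff.2 (Ideal.sum_mem _ fun t' _ => coeff_mem_iff.1 (hc' t t'))
  refine ⟨c', fun t => mem_ker_map_iff.2 (hc t), fun t => ?_⟩
  refine eq_of_logCoord_eq p γ (hc t) (coeff_mem_iff.2 (Ideal.add_mem _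
    (coeff_mem_iff.1 (hε' t)) (coeff_mem_iff.1 (hsum t)))) fun k => ?_
  rw [logCoord_add p γ (hε' t) (hsum t), logCoord_sum p γ _ (fun t' _ => hc' t t'), hcβ, hβ']
  congr 1
  refine Finset.sum_congr rfl fun t' _ => ?_
  rw [mul_comm (relSigmaDot p γ (c' t')), logCoord_mul p γ _ (relSigmaDot_coeff_mem γ (c' t') (hc t')),
    logCoord_relSigmaDot γ (c' t') (hc t')]
  exact congrArg _ (hcβ t' (k + 1)).symm

variable {γ}

theorem RelDisplay.reductionHom_surjective (hs : Function.Surjective (algebraMap S R))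
    (hS : IsNilpotent (p : S)) (P₁ P₂ : RelDisplay p γ)
    (hfin : IsFiniteLength S (RingHom.ker (algebraMap S R))) :
    Function.Surjective (RelDisplay.reductionHom P₁ P₂ hs) := by
  have := (isFiniteLength_iff_isNoetherian_isArtinian.1 hfin).2
  let _ : Algebra (WittVector p S) (WittVector p R) :=
    (WittVector.map (algebraMap S R)).toAlgebra
  exact baseChange_surjective_of_solvable (reduction_baseChangeData p γ hs) (frobeniusFrame γ hs hS)
    fun n g ε hε => exists_eq_add_sum_relSigmaDot γ n g ε hε

theorem RelDisplay.reductionHom_bijective (hs : Function.Surjective (algebraMap S R))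
    (hS : IsNilpotent (p : S)) (P₁ P₂ : RelDisplay p γ)
    (hP : Display.IsNilpotent (RelDisplay.reduction P₁ hs)) :
    Function.Bijective (RelDisplay.reductionHom P₁ P₂ hs) := by
  let _ : Algebra (WittVector p S) (WittVector p R) :=
    (WittVector.map (algebraMap S R)).toAlgebra
  have h := reduction_baseChangeData p γ hs
  obtain ⟨V, hV, N, hN⟩ := hP
  obtain ⟨j, hj⟩ := hS
  -- Each block of N + 1 steps gives a factor p, and `j` blocks give p^j, which annihilates W(𝔞)P₂.
  refine baseChange_bijective h (frobeniusFrame γ hs ⟨j, hj⟩) (m := j * (N + 1)) fun b hb => ?_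
  ext x
  obtain ⟨z, hz⟩ := hb.mem_pow_smul (p := p) (K := (RingHom.ker (constantCoeff : WittVector p R →+* R) ⊔
      Ideal.span {(p : WittVector p R)}).comap (algebraMap (WittVector p S) (WittVector p R)))
    (fun a ha => frobenius_mem_span_of_map_mem γ hs ha)
    (fun X _ _ φ b hb x => hb.mem_smul_of_baseChange h (fun a ha => frobenius_mem_of_mem ha) hV hN x)
    j x
  rw [hz, LinearMap.zero_apply, Submodule.coe_smul, Submodule.coe_zero]
  have h1 := (mem_baseChangeKer_iff h).1 z.2
  refine Submodule.smul_induction_on (p := fun z => (p : WittVector p S) ^ j • z = 0) h1 ?_ ?_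
  · intro a ha y _
    rw [smul_smul, ← Nat.cast_pow,
      natCast_mul_eq_zero_of_coeff_mem p γ (by rw [Nat.cast_pow, hj]) (mem_ker_map_iff.1 ha), zero_smul]
  · intro y z hy hz
    rw [smul_add, hy, hz, add_zero]

end Relative

theorem mainTheorem10 (p : ℕ) [Fact p.Prime] {S R : Type u} [CommRing S] [CommRing R]
    [Algebra S R] (hs : Function.Surjective (algebraMap S R)) (hp : IsNilpotent (p : S))
    (γ : DividedPowers (RingHom.ker (algebraMap S R))) (P₁ P₂ : RelDisplay p γ) :
    (IsFiniteLength S (RingHom.ker (algebraMap S R)) →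
      Function.Surjective (RelDisplay.reductionHom P₁ P₂ hs)) ∧
    (Display.IsNilpotent (RelDisplay.reduction P₁ hs) →
      Display.IsNilpotent (RelDisplay.reduction P₂ hs) →
      Function.Bijective (RelDisplay.reductionHom P₁ P₂ hs)) :=
  ⟨RelDisplay.reductionHom_surjective hs hp P₁ P₂,
    fun hP _ => RelDisplay.reductionHom_bijective hs hp P₁ P₂ hP⟩
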